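/- **Setting.** For each stage $N\in\mathbb N$ let $P_{XV}$ and $P_{YW}$ be probability measures on $\mathcal X\times\mathcal V$ and $\mathcal X\times\mathcal W$ with first marginals $P_X,P_Y$, let $k$ be a measurable positive definite kernel on $\mathcal X$ with $\int\sqrt{k(x,x)}\,dP_X(x)<\infty$, and let $n_1,n_2,m_1,m_2$ be sample sizes; all of these may depend on $N$. Assume $n_1\wedge n_2\to\infty$, $n_1\asymp m_1$, $n_2\asymp m_2$, and that the null hypothesis $P_X=P_Y$ holds at every stage. Limits, $o(1)$ and $o_P(1)$ are as $N\to\infty$; a ratio with denominator $0$ is counted as $+\infty$. Let $\overline k(x,y)=k(x,y)-\mathbb E[k(x,X_2)]-\mathbb E[k(X_1,y)]+\mathbb E[k(X_1,X_2)]$ and $\overline g(x,y)=\mathbb E[\overline k(x,X_1)\overline k(y,X_1)]$ for $X,X_1,X_2,X_3$ i.i.d. from $P_X$ (which equals $P_Y$). Let $\overline k(x,y)=\sum_i\lambda_i\phi_i(x)\phi_i(y)$ be a (finite or countably infinite) spectral decomposition: the $\phi_i$ are orthonormal eigenfunctions in $L^2(P_X)$ of the integral operator of $\overline k$ with eigenvalues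 $\lambda_i$, and the series converges in $L^2(P_X\otimes P_X)$. Let $\widehat f(x)=n_1^{-1}\sum_{j\le n_1}k(\widetilde X_j,x)-n_2^{-1}\sum_{j\le n_2}k(\widetilde Y_j,x)$, where $\widetilde X_j\sim P_X$, $\widetilde Y_j\sim P_Y$ are independent samples, independent of the labeled samples $(X_j,V_j)_{j\le n_1}\sim P_{XV}$ i.i.d. and $(Y_j,W_j)_{j\le n_2}\sim P_{YW}$ i.i.d. On each of the two folds $I$ (odd indices, even indices) of the labeled sample, let $\widehat{\mathbb E}[g(X)\mid V=v]=\sum_{j\in I}w_j(v)\,g(X_j)$ be a linear smoother, with measurable weights that may depend on the training data $(X_j,V_j)_{j\in I}$ but not on $g$; likewise for $(Y,W)$. In the conditions below $(X,V)\sim P_{XV}$ and $(Y,W)\sim P_{YW}$ are new observations independent of everything else. **Assumptions.** For each fold: 1. The smoothers are affine equivariant: for all measurable $g$ and all $a,b\in\mathbb R$, almost surely $\widehat{\mathbb E}[a\,g(X)+b\mid V]=a\,\widehat{\mathbb E}[g(X)\mid V]+b$ and $\widehat{\mathbb E}[a\,g(Y)+b\mid W]=a\,\widehat{\mathbb E}[g(Y)\mid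 W]+b$. 2. $\sup_i\mathbb E[\Delta_{X,i}^2]=o(1)$ and $\sup_i\mathbb E[\Delta_{Y,i}^2]=o(1)$, where $\Delta_{X,i}=\mathbb E[\phi_i(X)\mid V]-\widehat{\mathbb E}[\phi_i(X)\mid V]$, $\Delta_{Y,i}=\mathbb E[\phi_i(Y)\mid W]-\widehat{\mathbb E}[\phi_i(Y)\mid W]$, and the expectations are over the training fold and the new observation. Moreover, for both $r=1$ and $r=2$, $$\frac{\mathbb E[\overline k(X_1,X_2)^4]+n_r\,\mathbb E[\overline k(X_1,X_2)^2\,\overline k(X_1,X_3)^2]}{n_r^2\,\{\mathbb E[\overline g(X,X)]\}^2}=o(1).$$ **Conclusion.** For each fold, $$\frac{\mathbb E\bigl[\{\mathbb E[\widehat f(X)\mid V,\widehat f]-\widehat{\mathbb E}[\widehat f(X)\mid V,\widehat f]\}^2\,\big|\,\widehat f\bigr]}{\mathrm{Var}\{\widehat f(X)\mid\widehat f\}}=o_P(1) \quad\text{and}\quad \frac{\mathbb E\bigl[\{\mathbb E[\widehat f(Y)\mid W,\widehat f]-\widehat{\mathbb E}[\widehat f(Y)\mid W,\widehat f]\}^2\,\big|\,\widehat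 f\bigr]}{\mathrm{Var}\{\widehat f(Y)\mid\widehat f\}}=o_P(1),$$ where, given $\widehat f$, the expectations are over the training fold and the new observation. -/

import Mathlib

open MeasureTheory ProbabilityTheory Filter Topology Asymptotics
open scoped ENNReal

noncomputable section

/-- The ratio `a / b` of nonnegative extended reals. A ratio with zero denominator is undefined; it
is given the value `∞`, so that it never counts as small. -/
def defRatio (a b : ℝ≥0∞) : ℝ≥0∞ := if b = 0 then ∞ else a / b

/-- `R N = o_P(1)` as `N → ∞`, for nonnegative (extended-real valued) functions `R N` on probability
spaces `(Ω N, μ N)` that may change with `N`. -/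
def IsLittleOP {Ω : ℕ → Type*} [∀ N, MeasurableSpace (Ω N)] (μ : ∀ N, Measure (Ω N))
    (R : ∀ N, Ω N → ℝ≥0∞) : Prop :=
  ∀ ε : ℝ, 0 < ε → Tendsto (fun N => μ N {z | ENNReal.ofReal ε ≤ R N z}) atTop (𝓝 0)

/-- A (symmetric) positive definite kernel: all its Gram matrices are positive semidefinite. -/
def IsPosDefKernel {𝒳 : Type*} (k : 𝒳 → 𝒳 → ℝ) : Prop :=
  ∀ (n : ℕ) (x : Fin n → 𝒳), (Matrix.of fun i j : Fin n => k (x i) (x j)).PosSemidef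

section Kernel

variable {𝒳 : Type*} [MeasurableSpace 𝒳]

/-- The kernel `k` centered with respect to `P`:
`k(x, y) - E[k(x, X₂)] - E[k(X₁, y)] + E[k(X₁, X₂)]` for `X₁, X₂` i.i.d. from `P`. -/
def centeredKernel (P : Measure 𝒳) (k : 𝒳 → 𝒳 → ℝ) (x y : 𝒳) : ℝ :=
  k x y - (∫ b, k x b ∂P) - (∫ a, k a y ∂P) + ∫ a, ∫ b, k a b ∂P ∂P

/-- The expected product `g(x, y) = E[k̄(x, X) k̄(y, X)]` of the centered kernel, with `X ∼ P`. -/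
def expectedProduct (P : Measure 𝒳) (k : 𝒳 → 𝒳 → ℝ) (x y : 𝒳) : ℝ :=
  ∫ a, centeredKernel P k x a * centeredKernel P k y a ∂P

/-- `E[k̄(X₁, X₂)⁴] + n E[k̄(X₁, X₂)² k̄(X₁, X₃)²]` divided by `n² (E[g(X, X)])²`,
for `X, X₁, X₂, X₃` i.i.d. from `P`. -/
def nullRatio (P : Measure 𝒳) (k : 𝒳 → 𝒳 → ℝ) (n : ℕ) : ℝ≥0∞ :=
  defRatio
    ((∫⁻ x₁, ∫⁻ x₂, ‖centeredKernel P k x₁ x₂‖ₑ ^ 4 ∂P ∂P) +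
      (n : ℝ≥0∞) * ∫⁻ x₁, ∫⁻ x₂, ∫⁻ x₃,
        ‖centeredKernel P k x₁ x₂‖ₑ ^ 2 * ‖centeredKernel P k x₁ x₃‖ₑ ^ 2 ∂P ∂P ∂P)
    ((n : ℝ≥0∞) ^ 2 * ENNReal.ofReal (∫ x, expectedProduct P k x x ∂P) ^ 2)

/-- `κ(x, y) = ∑ i, lam i * φ i x * φ i y` is a spectral decomposition of the kernel `κ` under `P`:
the `φ i` are orthonormal in `L²(P)`, they are eigenfunctions of the integral operator of `κ` with
eigenvalues `lam i`, and the series converges to `κ` in `L²(P ⊗ P)`. -/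
structure IsSpectralDecomposition {ι : Type*} (P : Measure 𝒳) (κ : 𝒳 → 𝒳 → ℝ)
    (lam : ι → ℝ) (φ : ι → 𝒳 → ℝ) : Prop where
  measurable : ∀ i, Measurable (φ i)
  memLp : ∀ i, MemLp (φ i) 2 P
  norm_one : ∀ i, ∫ x, φ i x ^ 2 ∂P = 1
  orthogonal : ∀ i j, i ≠ j → ∫ x, φ i x * φ j x ∂P = 0
  eigen : ∀ i, ∀ᵐ x ∂P, ∫ y, κ x y * φ i y ∂P = lam i * φ i x
  expansion : Tendsto
    (fun s : Finset ι =>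
      ∫⁻ p, ‖κ p.1 p.2 - ∑ i ∈ s, lam i * φ i p.1 * φ i p.2‖ₑ ^ 2 ∂(P.prod P)) atTop (𝓝 0)

/-- The estimated witness function `x ↦ n₁⁻¹ ∑ k(x̃ᵢ, x) - n₂⁻¹ ∑ k(ỹᵢ, x)`. -/
def witness (k : 𝒳 → 𝒳 → ℝ) {n₁ n₂ : ℕ} (z : (Fin n₁ → 𝒳) × (Fin n₂ → 𝒳)) (x : 𝒳) : ℝ :=
  (n₁ : ℝ)⁻¹ * ∑ i, k (z.1 i) x - (n₂ : ℝ)⁻¹ * ∑ i, k (z.2 i) x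

/-- The joint law of the two independent i.i.d. samples `X̃₁, …, X̃ₙ₁ ∼ P` and `Ỹ₁, …, Ỹₙ₂ ∼ Q`
from which the witness function is built. -/
def witnessLaw (P Q : Measure 𝒳) (n₁ n₂ : ℕ) : Measure ((Fin n₁ → 𝒳) × (Fin n₂ → 𝒳)) :=
  (Measure.pi fun _ : Fin n₁ => P).prod (Measure.pi fun _ : Fin n₂ => Q)

end Kernel

/-- The two folds of the labeled sample of size `n`. As `Fin n` counts from `0`, `Fold n true`
consists of the observations number 1, 3, 5, … and `Fold n false` of those number 2, 4, 6, … -/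
abbrev Fold (n : ℕ) (b : Bool) : Type := {j : Fin n // decide (Even (j : ℕ)) = b}

/-- A linear smoother trained on a sample `((X_j, V_j))_{j ∈ J}`: measurable weights
`w_j(v)`, which may depend on the training sample but not on the function of `X` to be regressed. -/
structure LinearSmoother (J 𝒳 𝒱 : Type*) [MeasurableSpace 𝒳] [MeasurableSpace 𝒱] where
  weight : (J → 𝒳 × 𝒱) → 𝒱 → J → ℝ
  measurable_weight : ∀ j, Measurable fun q : (J → 𝒳 × 𝒱) × 𝒱 => weight q.1 q.2 j

namespace LinearSmoother

variable {J 𝒳 𝒱 : Type*} [Fintype J] [MeasurableSpace 𝒳] [MeasurableSpace 𝒱]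

/-- The estimate `Ê[g(X) | V = v] = ∑ j, w_j(v) g(X_j)`. -/
def estimate (S : LinearSmoother J 𝒳 𝒱) (g : 𝒳 → ℝ) (D : J → 𝒳 × 𝒱) (v : 𝒱) : ℝ :=
  ∑ j, S.weight D v j * g (D j).1

/-- `Ê[a g(X) + b | V] = a Ê[g(X) | V] + b` almost surely, where `V` is a new covariate that is
independent of the training sample, which is i.i.d. from `P`. -/
def AffineEquivariant (S : LinearSmoother J 𝒳 𝒱) (P : Measure (𝒳 × 𝒱)) : Prop :=
  ∀ g : 𝒳 → ℝ, Measurable g → ∀ a b : ℝ,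
    ∀ᵐ q ∂((Measure.pi fun _ : J => P).prod P.snd),
      S.estimate (fun x => a * g x + b) q.1 q.2 = a * S.estimate g q.1 q.2 + b

/-- `E[(E[g(X) | V] - Ê[g(X) | V])²]` for a fixed function `g`, where the expectation is over the
training sample, i.i.d. from `P`, and over a new observation `(X, V) ∼ P` independent of it. -/
def condMSE (S : LinearSmoother J 𝒳 𝒱) (P : Measure (𝒳 × 𝒱)) (g : 𝒳 → ℝ) : ℝ≥0∞ :=
  ∫⁻ q, ‖(P[fun p : 𝒳 × 𝒱 => g p.1 | MeasurableSpace.comap Prod.snd inferInstance]) q.2 -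
      S.estimate g q.1 q.2.2‖ₑ ^ 2 ∂((Measure.pi fun _ : J => P).prod P)

/-- `E[(E[f(X) | V, f] - Ê[f(X) | V, f])² | f] / Var(f(X) | f)` at a realization `f` of a random
function that is independent of the training sample and of the new observation `(X, V) ∼ P`; by
this independence, conditioning on the random function is the same as holding it fixed. -/
def crossFitRatio (S : LinearSmoother J 𝒳 𝒱) (P : Measure (𝒳 × 𝒱)) (f : 𝒳 → ℝ) : ℝ≥0∞ :=
  defRatio (S.condMSE P f) (ENNReal.ofReal (variance f P.fst))

end LinearSmoother

end

/-! Under the null the two witness samples merge into one i.i.d. sample `z` with weights `a j` equal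
to `1/n₁` or `-1/n₂`. These weights sum to zero, so the witness is `∑ j, a j * κ (z j) x` plus a
constant, with `κ` the centered kernel. Write `A = ∑ a j ^ 2` and `σ = E[κ(X₁, X₂)²] = ∑ lam i ^ 2`.
Numerator and denominator are both compared with `A * σ`.

Numerator (`exists_condMSE_le`): the residual is linear and ignores constants, so expanding `κ`
turns it into `∑ i, lam i * (∑ j, a j * φ i (z j)) * D i`, where `D i` is the residual of `φ i`. By
independence and orthonormality, averaging the square over `z` removes the cross terms and leaves `A
* ∑ lam i ^ 2 * D i ^ 2`. Hence the expected error is at most `A * σ` times the supremum of the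
errors for the eigenfunctions, and Markov's inequality applies.

Denominator (`measure_sum_sq_le`): by Bessel, the variance is at least `‖∑ a j • b (z j)‖²`, where
`b` lists `lam i * φ i` over a finite set carrying half of `σ`. This must rarely be far below `A *
σ`. No limit law is available, since the spectrum may change with `N`; instead the Laplace transform
`E exp(-t²‖v‖²/2)` is written as a Gaussian average of characteristic functions of `⟪ξ, v⟫`. These
factor over `j` and are bounded using second and fourth moments, so the transform is small up to an
error governed by `E[κ(X₁, X₂)² κ(X₁, X₃)²]`, which the moment condition makes negligible. -/

/-! ### Trigonometric bounds valid on the whole line. -/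

theorem cos_sq_le_quartic (x : ℝ) : Real.cos x ^ 2 ≤ 1 - x ^ 2 + 8 * x ^ 4 := by
  have h1 : Real.cos (2 * x) ≤ 1 - (2 * x) ^ 2 / 2 + (2 * x) ^ 4 := by
    rcases le_or_gt |2 * x| 1 with h | h
    · have := abs_le.1 (Real.cos_bound h)
      have h4 : |2 * x| ^ 4 = (2 * x) ^ 4 := by
        rw [show (4 : ℕ) = 2 * 2 by norm_num, pow_mul, sq_abs, ← pow_mul]
      rw [h4] at this
      nlinarith [this.2, sq_nonneg ((2 * x) ^ 2)]
    -- Away from the origin the quartic term outweighs the quadratic one, so the trivial bound on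
    -- the cosine is enough.
    · have h2 : 1 < (2 * x) ^ 2 := by
        rw [← sq_abs]; nlinarith
      nlinarith [Real.cos_le_one (2 * x)]
  rw [Real.cos_sq]
  nlinarith [h1, sq_nonneg (x ^ 2)]

theorem sin_sub_self_sq_le (x : ℝ) : (Real.sin x - x) ^ 2 ≤ 4 * x ^ 4 := by
  have key : ∀ y : ℝ, 0 ≤ y → |Real.sin y - y| ≤ 2 * y ^ 2 := by
    intro y hy
    rcases hy.eq_or_lt with rfl | hy
    · simp
    rcases le_or_gt y 1 with h | h
    · have h1 := Real.sin_gt_sub_cube hy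
      have h2 := Real.sin_le hy.le
      rw [abs_le]
      constructor <;> nlinarith [sq_nonneg y, mul_pos hy hy]
    · have h1 := Real.neg_one_le_sin y
      have h2 := Real.sin_le hy.le
      rw [abs_le]
      constructor <;> nlinarith
  have h : |Real.sin x - x| ≤ 2 * x ^ 2 := by
    rcases le_total 0 x with hx | hx
    · exact key x hx
    · have := key (-x) (by linarith)
      rw [Real.sin_neg, ← abs_neg] at this
      simpa [sub_eq_add_neg, add_comm] using this
  calc (Real.sin x - x) ^ 2 = |Real.sin x - x| ^ 2 := (sq_abs _).symm
    _ ≤ (2 * x ^ 2) ^ 2 := by gcongr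
    _ = 4 * x ^ 4 := by ring

/-! ### Decay of characteristic functions of weighted i.i.d. sums. -/

section CharFun

variable {α : Type*} [MeasurableSpace α] {P : Measure α} [IsProbabilityMeasure P]

theorem sq_integral_le_integral_sq {f : α → ℝ} (hf : AEStronglyMeasurable f P)
    (hf2 : Integrable (fun x => f x ^ 2) P) : (∫ x, f x ∂P) ^ 2 ≤ ∫ x, f x ^ 2 ∂P := by
  have hL : MemLp f 2 P := (memLp_two_iff_integrable_sq hf).2 hf2
  have := variance_nonneg f P
  rw [variance_eq_sub hL] at this
  simpa using this

/-- Real and imaginary parts are treated separately by Jensen. Centering allows `sin` to be replaced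
by `sin y - y`, whose square is of fourth order. No third moment enters, and `12 = 8 + 4` adds the
two constants. -/
theorem sq_norm_integral_exp_le {h : α → ℝ} (hm : Measurable h) (h0 : ∫ x, h x ∂P = 0)
    (h4 : Integrable (fun x => h x ^ 4) P) (t : ℝ) :
    ‖∫ x, Complex.exp ((t * h x : ℝ) * Complex.I) ∂P‖ ^ 2
      ≤ 1 - t ^ 2 * ∫ x, h x ^ 2 ∂P + 12 * t ^ 4 * ∫ x, h x ^ 4 ∂P := by
  have h2 : Integrable (fun x => h x ^ 2) P := by
    refine (h4.add (integrable_const (1 : ℝ))).mono' (by fun_prop) (ae_of_all _ fun x => ?_)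
    rw [Real.norm_eq_abs, abs_of_nonneg (sq_nonneg _)]
    simp only [Pi.add_apply]
    nlinarith [sq_nonneg (h x ^ 2 - 1)]
  have h1 : Integrable h P := by
    refine (h2.add (integrable_const (1 : ℝ))).mono' (by fun_prop) (ae_of_all _ fun x => ?_)
    simp only [Pi.add_apply, Real.norm_eq_abs]
    nlinarith [sq_abs (h x), sq_nonneg (|h x| - 1), abs_nonneg (h x)]
  have hbd : ∀ f : α → ℝ, Measurable f → (∀ x, |f x| ≤ 1) → Integrable f P := fun f hf hb =>
    (integrable_const (1 : ℝ)).mono' hf.aestronglyMeasurable (ae_of_all _ hb)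
  have hcos : Integrable (fun x => Real.cos (t * h x)) P :=
    hbd _ (by fun_prop) fun x => Real.abs_cos_le_one _
  have hsin : Integrable (fun x => Real.sin (t * h x)) P :=
    hbd _ (by fun_prop) fun x => Real.abs_sin_le_one _
  have hsplit : ∫ x, Complex.exp ((t * h x : ℝ) * Complex.I) ∂P
      = (∫ x, Real.cos (t * h x) ∂P : ℝ) + (∫ x, Real.sin (t * h x) ∂P : ℝ) * Complex.I := by
    rw [← integral_complex_ofReal, ← integral_complex_ofReal, ← integral_mul_const,
      ← integral_add hcos.ofReal (hsin.ofReal.mul_const _)]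
    congr 1 with x
    rw [Complex.exp_mul_I, Complex.ofReal_cos, Complex.ofReal_sin]
  rw [hsplit, ← Complex.normSq_eq_norm_sq, Complex.normSq_add_mul_I]
  have hc : (∫ x, Real.cos (t * h x) ∂P) ^ 2
      ≤ 1 - t ^ 2 * ∫ x, h x ^ 2 ∂P + 8 * t ^ 4 * ∫ x, h x ^ 4 ∂P := by
    have hi : Integrable (fun x => Real.cos (t * h x) ^ 2) P :=
      hbd _ (by fun_prop) fun x => by
        rw [abs_of_nonneg (sq_nonneg _)]; exact Real.cos_sq_le_one _
    refine (sq_integral_le_integral_sq hcos.1 hi).trans ?_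
    have hR1 : Integrable (fun x => 1 - t ^ 2 * h x ^ 2) P :=
      (integrable_const _).sub (h2.const_mul _)
    have hR : Integrable (fun x => (1 - t ^ 2 * h x ^ 2) + 8 * t ^ 4 * h x ^ 4) P :=
      hR1.add (h4.const_mul _)
    refine (integral_mono hi hR fun x => ?_).trans (le_of_eq ?_)
    · refine (cos_sq_le_quartic (t * h x)).trans (le_of_eq (by ring))
    · rw [integral_add hR1 (h4.const_mul _), integral_sub (integrable_const _) (h2.const_mul _),
        integral_const_mul, integral_const_mul]
      simp
  have hs : (∫ x, Real.sin (t * h x) ∂P) ^ 2 ≤ 4 * t ^ 4 * ∫ x, h x ^ 4 ∂P := by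
    have e : ∫ x, Real.sin (t * h x) ∂P = ∫ x, (Real.sin (t * h x) - t * h x) ∂P := by
      rw [integral_sub hsin (h1.const_mul _), integral_const_mul, h0]; simp
    have hb : ∀ x, (Real.sin (t * h x) - t * h x) ^ 2 ≤ 4 * t ^ 4 * h x ^ 4 := fun x =>
      (sin_sub_self_sq_le (t * h x)).trans (le_of_eq (by ring))
    have hi : Integrable (fun x => (Real.sin (t * h x) - t * h x) ^ 2) P := by
      refine (h4.const_mul (4 * t ^ 4)).mono' (by fun_prop) (ae_of_all _ fun x => ?_)
      rw [Real.norm_eq_abs, abs_of_nonneg (sq_nonneg _)]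
      exact hb x
    rw [e]
    refine (sq_integral_le_integral_sq (hsin.sub (h1.const_mul _)).1 hi).trans ?_
    rw [← integral_const_mul]
    exact integral_mono hi (h4.const_mul _) hb
  linarith

/-- Multiplying the bounds for single factors puts the fourth moment in an exponent, where it could
not later be averaged over a Gaussian vector. Either the quartic term is at least 1 and the trivial
bound 1 suffices, or its exponential is at most `e`; so it can be made additive. -/
theorem prod_norm_integral_exp_le {J : Type*} [Fintype J] (a : J → ℝ) {h : α → ℝ}
    (hm : Measurable h) (h0 : ∫ x, h x ∂P = 0) (h4 : Integrable (fun x => h x ^ 4) P) (t : ℝ) :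
    ∏ j, ‖∫ x, Complex.exp ((t * a j * h x : ℝ) * Complex.I) ∂P‖
      ≤ Real.exp 1 * Real.exp (-(t ^ 2 * (∑ j, a j ^ 2) / 2 * ∫ x, h x ^ 2 ∂P))
        + 6 * t ^ 4 * (∑ j, a j ^ 4) * ∫ x, h x ^ 4 ∂P := by
  set s := ∫ x, h x ^ 2 ∂P
  set m := ∫ x, h x ^ 4 ∂P
  have hm0 : 0 ≤ m := integral_nonneg fun x => by positivity
  have hA4 : 0 ≤ ∑ j, a j ^ 4 := Finset.sum_nonneg fun j _ => by positivity
  have hone : ∀ u : ℝ, ‖∫ x, Complex.exp ((u * h x : ℝ) * Complex.I) ∂P‖ ≤ 1 := fun u => by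
    refine (norm_integral_le_of_norm_le_const (C := 1) (ae_of_all _ fun x => ?_)).trans (by simp)
    rw [Complex.norm_exp_ofReal_mul_I]
  have hB0 : 0 ≤ 6 * t ^ 4 * (∑ j, a j ^ 4) * m := by positivity
  rcases le_or_gt 1 (6 * t ^ 4 * (∑ j, a j ^ 4) * m) with hB | hB
  · refine (Finset.prod_le_one (fun j _ => norm_nonneg _) fun j _ => hone _).trans ?_
    have : 0 < Real.exp 1 * Real.exp (-(t ^ 2 * (∑ j, a j ^ 2) / 2 * s)) := by positivity
    linarith
  · have hj : ∀ j, ‖∫ x, Complex.exp ((t * a j * h x : ℝ) * Complex.I) ∂P‖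
        ≤ Real.exp (-((t * a j) ^ 2 * s - 12 * (t * a j) ^ 4 * m) / 2) := fun j => by
      have h1 := sq_norm_integral_exp_le hm h0 h4 (t * a j)
      refine le_of_sq_le_sq ?_ (Real.exp_pos _).le
      rw [← Real.exp_nat_mul]
      refine h1.trans ?_
      have := Real.add_one_le_exp (-((t * a j) ^ 2 * s - 12 * (t * a j) ^ 4 * m))
      refine le_trans ?_ (this.trans (Real.exp_le_exp.2 ?_))
      · linarith
      · push_cast; linarith
    refine (Finset.prod_le_prod (fun j _ => norm_nonneg _) fun j _ => hj j).trans ?_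
    rw [← Real.exp_sum, ← Real.exp_add]
    have e : ∑ j, -((t * a j) ^ 2 * s - 12 * (t * a j) ^ 4 * m) / 2
        = -(t ^ 2 * (∑ j, a j ^ 2) / 2 * s) + 6 * t ^ 4 * (∑ j, a j ^ 4) * m := by
      simp only [Finset.mul_sum, Finset.sum_mul, Finset.sum_div, ← Finset.sum_neg_distrib,
        ← Finset.sum_add_distrib]
      exact Finset.sum_congr rfl fun j _ => by ring
    rw [e]
    have : Real.exp (-(t ^ 2 * (∑ j, a j ^ 2) / 2 * s) + 6 * t ^ 4 * (∑ j, a j ^ 4) * m)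
        ≤ Real.exp (1 + -(t ^ 2 * (∑ j, a j ^ 2) / 2 * s)) := Real.exp_le_exp.2 (by linarith)
    linarith

end CharFun

/-! ### Gaussian averaging and Laplace transforms of squared norms. -/

section Gaussian

open scoped RealInnerProductSpace

variable {E : Type*} [NormedAddCommGroup E] [InnerProductSpace ℝ E] [FiniteDimensional ℝ E]
  [MeasurableSpace E] [BorelSpace E]

theorem map_inner_stdGaussian (b : E) :
    (stdGaussian E).map (fun ξ => ⟪ξ, b⟫) = (gaussianReal 0 1).map (fun x => ‖b‖ * x) := by
  have : IsProbabilityMeasure ((stdGaussian E).map (fun ξ => ⟪ξ, b⟫)) :=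
    Measure.isProbabilityMeasure_map (by fun_prop)
  have : IsProbabilityMeasure ((gaussianReal 0 1).map (fun x => ‖b‖ * x)) :=
    Measure.isProbabilityMeasure_map (by fun_prop)
  refine Measure.ext_of_charFun (funext fun t => ?_)
  have h1 : charFun ((stdGaussian E).map (fun ξ => ⟪ξ, b⟫)) t
      = charFun (stdGaussian E) (t • b) := by
    rw [charFun_apply_real, charFun_apply, integral_map (by fun_prop) (by fun_prop)]
    simp [inner_smul_right]
  rw [h1, charFun_stdGaussian, gaussianReal_map_const_mul, charFun_gaussianReal, norm_smul,
    Complex.ofReal_mul, mul_pow, ← Complex.ofReal_pow ‖t‖, Real.norm_eq_abs, sq_abs]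
  congr 1
  simp
  ring

/-- The fourth moment of the standard normal distribution. -/
noncomputable def gaussianFourthMoment : ℝ := ∫ x, x ^ 4 ∂(gaussianReal 0 1)

theorem gaussianFourthMoment_nonneg : 0 ≤ gaussianFourthMoment :=
  integral_nonneg fun x => by positivity

theorem integral_inner_pow_four_stdGaussian (b : E) :
    ∫ ξ, ⟪ξ, b⟫ ^ 4 ∂(stdGaussian E) = gaussianFourthMoment * ‖b‖ ^ 4 := by
  have h : ∫ y, y ^ 4 ∂((stdGaussian E).map (fun ξ => ⟪ξ, b⟫)) = ∫ ξ, ⟪ξ, b⟫ ^ 4 ∂(stdGaussian E) :=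
    integral_map (by fun_prop) (by fun_prop)
  rw [← h, map_inner_stdGaussian, integral_map (by fun_prop) (by fun_prop)]
  simp_rw [mul_pow]
  rw [integral_const_mul, gaussianFourthMoment, mul_comm]

theorem integral_exp_neg_mul_sq_gaussianReal {c : ℝ} (hc : 0 ≤ c) :
    ∫ x, Real.exp (-(c * x ^ 2)) ∂(gaussianReal 0 1) = (Real.sqrt (1 + 2 * c))⁻¹ := by
  rw [integral_gaussianReal_eq_integral_smul one_ne_zero]
  simp only [gaussianPDFReal, smul_eq_mul, NNReal.coe_one, mul_one, sub_zero]
  have e : ∀ x : ℝ, (Real.sqrt (2 * Real.pi))⁻¹ * Real.exp (-x ^ 2 / 2) * Real.exp (-(c * x ^ 2))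
      = (Real.sqrt (2 * Real.pi))⁻¹ * Real.exp (-(1 / 2 + c) * x ^ 2) := fun x => by
    rw [mul_assoc, ← Real.exp_add]; ring_nf
  simp_rw [e]
  rw [integral_const_mul, integral_gaussian, ← Real.sqrt_inv, ← Real.sqrt_inv,
    ← Real.sqrt_mul (by positivity)]
  congr 1
  have := Real.pi_pos
  field_simp

theorem integral_exp_neg_inner_sq_stdGaussian {b : E} (hb : ‖b‖ = 1) {c : ℝ} (hc : 0 ≤ c) :
    ∫ ξ, Real.exp (-(c * ⟪ξ, b⟫ ^ 2)) ∂(stdGaussian E) = (Real.sqrt (1 + 2 * c))⁻¹ := by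
  have h : ∫ y, Real.exp (-(c * y ^ 2)) ∂((stdGaussian E).map (fun ξ => ⟪ξ, b⟫))
      = ∫ ξ, Real.exp (-(c * ⟪ξ, b⟫ ^ 2)) ∂(stdGaussian E) :=
    integral_map (by fun_prop) (by fun_prop)
  rw [← h, map_inner_stdGaussian, integral_map (by fun_prop) (by fun_prop), hb]
  simpa using integral_exp_neg_mul_sq_gaussianReal hc

/-- By convexity of the exponential function, a weighted sum of squares of standard normal variables
is not too concentrated at `0`. -/
theorem integral_exp_neg_sum_sq_stdGaussian_le {s : Type*} [Fintype s] {w : s → ℝ}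
    (hw : ∀ i, 0 ≤ w i) (hW : 0 < ∑ i, w i) :
    ∫ ξ, Real.exp (-∑ i, w i * ξ i ^ 2) ∂(stdGaussian (EuclideanSpace ℝ s))
      ≤ (Real.sqrt (1 + 2 * ∑ i, w i))⁻¹ := by
  set W := ∑ i, w i
  have hint : ∀ f : EuclideanSpace ℝ s → ℝ, Measurable f → (∀ ξ, 0 ≤ f ξ) →
      Integrable (fun ξ => Real.exp (-f ξ)) (stdGaussian (EuclideanSpace ℝ s)) := fun f hf h0 =>
    (integrable_const (1 : ℝ)).mono' (by fun_prop) (ae_of_all _ fun ξ => by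
      rw [Real.norm_eq_abs, Real.abs_exp]; exact Real.exp_le_one_iff.2 (neg_nonpos.2 (h0 ξ)))
  have hI : ∀ i, Integrable (fun ξ : EuclideanSpace ℝ s => Real.exp (-(W * ξ i ^ 2)))
      (stdGaussian (EuclideanSpace ℝ s)) := fun i =>
    hint (fun ξ => W * ξ i ^ 2) (by fun_prop) fun ξ => by positivity
  calc ∫ ξ, Real.exp (-∑ i, w i * ξ i ^ 2) ∂(stdGaussian (EuclideanSpace ℝ s))
      ≤ ∫ ξ, ∑ i, (w i / W) * Real.exp (-(W * ξ i ^ 2)) ∂(stdGaussian (EuclideanSpace ℝ s)) := by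
        refine integral_mono (hint (fun ξ => ∑ i, w i * ξ i ^ 2) (by fun_prop) fun ξ =>
          Finset.sum_nonneg fun i _ => mul_nonneg (hw i) (sq_nonneg _))
          (integrable_finsetSum _ fun i _ => (hI i).const_mul _) fun ξ => ?_
        -- The exponent is a convex combination, with weights `w i / W`, of the one-dimensional
        -- exponents `-W * ξ i ^ 2`.
        have := convexOn_exp.map_sum_le (t := Finset.univ) (w := fun i => w i / W)
          (p := fun i => -(W * ξ i ^ 2)) (fun i _ => div_nonneg (hw i) hW.le)
          (by rw [← Finset.sum_div]; exact div_self hW.ne') (fun _ _ => Set.mem_univ _)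
        simp only [smul_eq_mul] at this
        refine le_trans (le_of_eq ?_) this
        congr 1
        rw [← Finset.sum_neg_distrib]
        exact Finset.sum_congr rfl fun i _ => by field_simp
    _ = ∑ i, (w i / W) * (Real.sqrt (1 + 2 * W))⁻¹ := by
        rw [integral_finsetSum _ fun i _ => (hI i).const_mul _]
        classical
        refine Finset.sum_congr rfl fun i _ => ?_
        rw [integral_const_mul, ← integral_exp_neg_inner_sq_stdGaussian
          (b := EuclideanSpace.single i (1 : ℝ)) (by simp) hW.le]
        simp [EuclideanSpace.inner_single_right]
    _ = (Real.sqrt (1 + 2 * W))⁻¹ := by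
        rw [← Finset.sum_mul, ← Finset.sum_div, div_self hW.ne', one_mul]

/-- A Gaussian density is, up to scaling, its own Fourier transform: `exp(-t²‖v‖²/2)` is the mean of
`exp(i t ⟪ξ, v⟫)` over a standard Gaussian `ξ`. After Fubini, for fixed `ξ`, the sample is
integrated out by independence and only the scalar variables `⟪ξ, b x⟫` matter. -/
theorem integral_exp_neg_sq_norm_sum_le {α : Type*} [MeasurableSpace α] {P : Measure α}
    [IsProbabilityMeasure P] {J : Type*} [Fintype J] (a : J → ℝ) {b : α → E} (hb : Measurable b)
    (hb0 : ∀ ξ, ∫ x, ⟪ξ, b x⟫ ∂P = 0) (hb4 : Integrable (fun x => ‖b x‖ ^ 4) P) (t : ℝ) :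
    ∫ z, Real.exp (-(t ^ 2 / 2 * ‖∑ j, a j • b (z j)‖ ^ 2)) ∂(Measure.pi fun _ : J => P)
      ≤ Real.exp 1 * ∫ ξ, Real.exp (-(t ^ 2 * (∑ j, a j ^ 2) / 2 * ∫ x, ⟪ξ, b x⟫ ^ 2 ∂P))
          ∂(stdGaussian E)
        + 6 * t ^ 4 * (∑ j, a j ^ 4) * (gaussianFourthMoment * ∫ x, ‖b x‖ ^ 4 ∂P) := by
  set γ := stdGaussian E
  set M := Measure.pi fun _ : J => P
  set v : (J → α) → E := fun z => ∑ j, a j • b (z j)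
  have hv : Measurable v := Finset.measurable_sum _ fun j _ => by fun_prop
  have hξ4 : Integrable (fun ξ : E => ‖ξ‖ ^ 4) γ :=
    (IsGaussian.memLp_id γ 4 (by simp)).integrable_norm_pow (by norm_num)
  have hmeas : Measurable fun p : E × α => ⟪p.1, b p.2⟫ := by fun_prop
  have hprod : Integrable (fun p : E × α => ⟪p.1, b p.2⟫ ^ 4) (γ.prod P) := by
    refine (hξ4.mul_prod hb4).mono' (by fun_prop) (ae_of_all _ fun p => ?_)
    rw [norm_pow, ← mul_pow]
    gcongr
    exact norm_inner_le_norm _ _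
  have hstep1 : ((∫ z, Real.exp (-(t ^ 2 / 2 * ‖v z‖ ^ 2)) ∂M : ℝ) : ℂ)
      = ∫ ξ, ∏ j, ∫ x, Complex.exp ((t * a j * ⟪ξ, b x⟫ : ℝ) * Complex.I) ∂P ∂γ := by
    rw [← integral_complex_ofReal]
    have e1 : ∀ z, ((Real.exp (-(t ^ 2 / 2 * ‖v z‖ ^ 2)) : ℝ) : ℂ)
        = ∫ ξ, Complex.exp ((⟪ξ, t • v z⟫ : ℝ) * Complex.I) ∂γ := fun z => by
      have := charFun_stdGaussian (t • v z)
      rw [charFun_apply] at this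
      rw [this, norm_smul, Complex.ofReal_mul, mul_pow, ← Complex.ofReal_pow ‖t‖, Real.norm_eq_abs,
        sq_abs]
      push_cast
      ring_nf
    simp_rw [e1]
    rw [integral_integral_swap]
    · refine integral_congr_ae (ae_of_all _ fun ξ => ?_)
      simp only
      rw [← integral_fintype_prod_eq_prod (𝕜 := ℂ)
        (f := fun j x => Complex.exp ((t * a j * ⟪ξ, b x⟫ : ℝ) * Complex.I))]
      refine integral_congr_ae (ae_of_all _ fun z => ?_)
      simp only [v]
      rw [← Complex.exp_sum, ← Finset.sum_mul, inner_smul_right, inner_sum, Finset.mul_sum]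
      push_cast
      simp only [inner_smul_right]
      push_cast
      simp only [mul_assoc]
    · refine (integrable_const (1 : ℝ)).mono' ?_ (ae_of_all _ fun p => ?_)
      · refine Measurable.aestronglyMeasurable ?_
        simp only [Function.uncurry_def]
        have : Measurable fun p : (J → α) × E => ⟪p.2, t • v p.1⟫ := by fun_prop
        fun_prop
      · rw [Function.uncurry_def, Complex.norm_exp_ofReal_mul_I]
  have hstep2 : ∫ z, Real.exp (-(t ^ 2 / 2 * ‖v z‖ ^ 2)) ∂M
      ≤ ∫ ξ, ∏ j, ‖∫ x, Complex.exp ((t * a j * ⟪ξ, b x⟫ : ℝ) * Complex.I) ∂P‖ ∂γ := by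
    calc _ ≤ ‖((∫ z, Real.exp (-(t ^ 2 / 2 * ‖v z‖ ^ 2)) ∂M : ℝ) : ℂ)‖ := by
          rw [Complex.norm_real]; exact Real.le_norm_self _
      _ ≤ _ := by
          rw [hstep1]
          refine (norm_integral_le_integral_norm _).trans (le_of_eq ?_)
          simp_rw [norm_prod]
  have hI4 : Integrable (fun ξ => ∫ x, ⟪ξ, b x⟫ ^ 4 ∂P) γ := hprod.integral_prod_left
  have hIe : Integrable
      (fun ξ => Real.exp (-(t ^ 2 * (∑ j, a j ^ 2) / 2 * ∫ x, ⟪ξ, b x⟫ ^ 2 ∂P))) γ := by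
    have hm : StronglyMeasurable fun ξ : E => ∫ x, ⟪ξ, b x⟫ ^ 2 ∂P :=
      StronglyMeasurable.integral_prod_right (f := fun ξ x => ⟪ξ, b x⟫ ^ 2)
        (hmeas.pow_const 2).stronglyMeasurable
    refine (integrable_const (1 : ℝ)).mono'
      (Real.measurable_exp.comp (hm.measurable.const_mul _).neg).aestronglyMeasurable
      (ae_of_all _ fun ξ => ?_)
    rw [Real.norm_eq_abs, Real.abs_exp]
    refine Real.exp_le_one_iff.2 (neg_nonpos.2 (mul_nonneg ?_ ?_))
    · exact div_nonneg (mul_nonneg (sq_nonneg _) (Finset.sum_nonneg fun j _ => sq_nonneg _))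
        two_pos.le
    · exact integral_nonneg fun x => sq_nonneg _
  have hint4 : ∀ ξ, Integrable (fun x => ⟪ξ, b x⟫ ^ 4) P := fun ξ => by
    refine (hb4.const_mul (‖ξ‖ ^ 4)).mono' (by fun_prop) (ae_of_all _ fun x => ?_)
    rw [norm_pow, ← mul_pow]
    gcongr
    exact norm_inner_le_norm _ _
  refine hstep2.trans ?_
  refine (integral_mono_of_nonneg (ae_of_all _ fun ξ => Finset.prod_nonneg fun j _ => norm_nonneg _)
    ((hIe.const_mul (Real.exp 1)).add (hI4.const_mul (6 * t ^ 4 * (∑ j, a j ^ 4))))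
    (ae_of_all _ fun ξ => prod_norm_integral_exp_le a (by fun_prop) (hb0 ξ) (hint4 ξ) t)).trans
    (le_of_eq ?_)
  rw [integral_add' (hIe.const_mul _) (hI4.const_mul _), integral_const_mul, integral_const_mul]
  congr 2
  have hsw : ∫ ξ, ∫ x, ⟪ξ, b x⟫ ^ 4 ∂P ∂γ = ∫ x, ∫ ξ, ⟪ξ, b x⟫ ^ 4 ∂γ ∂P :=
    integral_integral_swap (f := fun ξ x => ⟪ξ, b x⟫ ^ 4) hprod
  rw [hsw]
  simp_rw [γ, integral_inner_pow_four_stdGaussian]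
  rw [integral_const_mul]

end Gaussian

/-! ### Bessel and Parseval identities for the spectral decomposition. -/

section Kernel

variable {α : Type*} [MeasurableSpace α] {P : Measure α}

theorem integral_sum_mul_sq {ι : Type*} {φ : ι → α → ℝ} (hφ : ∀ i, MemLp (φ i) 2 P)
    (h1 : ∀ i, ∫ x, φ i x ^ 2 ∂P = 1) (h0 : ∀ i j, i ≠ j → ∫ x, φ i x * φ j x ∂P = 0)
    (c : ι → ℝ) (s : Finset ι) :
    ∫ x, (∑ i ∈ s, c i * φ i x) ^ 2 ∂P = ∑ i ∈ s, c i ^ 2 := by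
  classical
  have hij : ∀ i j, ∫ x, φ i x * φ j x ∂P = if i = j then 1 else 0 := fun i j => by
    split_ifs with h
    · subst h; simpa [sq] using h1 i
    · exact h0 i j h
  have hI : ∀ i j, Integrable (fun x => φ i x * φ j x) P := fun i j => (hφ i).integrable_mul (hφ j)
  have e : ∀ x, (∑ i ∈ s, c i * φ i x) ^ 2
      = ∑ i ∈ s, ∑ j ∈ s, c i * c j * (φ i x * φ j x) := fun x => by
    rw [sq, Finset.sum_mul_sum]
    exact Finset.sum_congr rfl fun i _ => Finset.sum_congr rfl fun j _ => by ring
  simp_rw [e]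
  rw [integral_finsetSum _ fun i _ => integrable_finsetSum _ fun j _ => (hI i j).const_mul _]
  refine Finset.sum_congr rfl fun i hi => ?_
  rw [integral_finsetSum _ fun j _ => (hI i j).const_mul _]
  simp_rw [integral_const_mul, hij]
  simp [hi, sq]

theorem integral_sub_sum_sq {ι : Type*} {φ : ι → α → ℝ} (hφ : ∀ i, MemLp (φ i) 2 P)
    (h1 : ∀ i, ∫ x, φ i x ^ 2 ∂P = 1) (h0 : ∀ i j, i ≠ j → ∫ x, φ i x * φ j x ∂P = 0)
    {f : α → ℝ} (hf : MemLp f 2 P) {c : ι → ℝ} (hc : ∀ i, ∫ x, f x * φ i x ∂P = c i)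
    (s : Finset ι) :
    ∫ x, (f x - ∑ i ∈ s, c i * φ i x) ^ 2 ∂P = ∫ x, f x ^ 2 ∂P - ∑ i ∈ s, c i ^ 2 := by
  have hfI : ∀ i, Integrable (fun x => f x * φ i x) P := fun i => hf.integrable_mul (hφ i)
  have e : ∀ x, (f x - ∑ i ∈ s, c i * φ i x) ^ 2 = f x ^ 2 - 2 * ∑ i ∈ s, c i * (f x * φ i x)
      + (∑ i ∈ s, c i * φ i x) ^ 2 := fun x => by
    rw [sub_sq, mul_assoc, Finset.mul_sum]
    congr 3
    exact Finset.sum_congr rfl fun i _ => by ring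
  have hA : Integrable (fun x => 2 * ∑ i ∈ s, c i * (f x * φ i x)) P :=
    (integrable_finsetSum _ fun i _ => (hfI i).const_mul _).const_mul _
  have hB : Integrable (fun x => (∑ i ∈ s, c i * φ i x) ^ 2) P :=
    (memLp_finsetSum s fun i _ => (hφ i).const_mul (c i)).integrable_sq
  have hAB : Integrable (fun x => f x ^ 2 - 2 * ∑ i ∈ s, c i * (f x * φ i x)) P :=
    hf.integrable_sq.sub hA
  simp_rw [e]
  rw [integral_add hAB hB, integral_sub hf.integrable_sq hA, integral_const_mul,
    integral_finsetSum _ fun i _ => (hfI i).const_mul _, integral_sum_mul_sq hφ h1 h0]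
  simp_rw [integral_const_mul, hc, ← sq]
  ring

namespace IsSpectralDecomposition

variable {ι : Type*} {κ : α → α → ℝ} {lam : ι → ℝ} {φ : ι → α → ℝ}

theorem memLp_partialSum (h : IsSpectralDecomposition P κ lam φ) (s : Finset ι) :
    MemLp (fun p : α × α => ∑ i ∈ s, lam i * φ i p.1 * φ i p.2) 2 (P.prod P) := by
  refine memLp_finsetSum _ fun i _ => ?_
  have hm := h.measurable i
  refine (memLp_two_iff_integrable_sq (Measurable.aestronglyMeasurable (by fun_prop))).2 ?_
  have := ((h.memLp i).integrable_sq.mul_prod (h.memLp i).integrable_sq).const_mul (lam i ^ 2)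
  refine this.congr (ae_of_all _ fun p => by simp only; ring)

/-- Convergence of the expansion makes some remainder square integrable, and partial sums are square
integrable anyway. -/
theorem memLp_uncurry [IsProbabilityMeasure P] (h : IsSpectralDecomposition P κ lam φ)
    (hκ : Measurable (Function.uncurry κ)) :
    MemLp (Function.uncurry κ) 2 (P.prod P) := by
  obtain ⟨s, hs⟩ := (h.expansion.eventually (gt_mem_nhds ENNReal.zero_lt_top)).exists
  have hm : Measurable fun p : α × α =>
      κ p.1 p.2 - ∑ i ∈ s, lam i * φ i p.1 * φ i p.2 := by
    have := h.measurable
    exact Measurable.sub hκ (by fun_prop)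
  have hL : MemLp (fun p : α × α => κ p.1 p.2 - ∑ i ∈ s, lam i * φ i p.1 * φ i p.2) 2
      (P.prod P) := by
    refine ⟨hm.aestronglyMeasurable, ?_⟩
    rw [eLpNorm_lt_top_iff_lintegral_rpow_enorm_lt_top two_ne_zero ENNReal.ofNat_ne_top]
    simpa using hs
  refine (hL.add (h.memLp_partialSum s)).congr_norm hκ.aestronglyMeasurable
    (ae_of_all _ fun p => ?_)
  simp [Function.uncurry]

theorem ae_memLp [IsProbabilityMeasure P] (h : IsSpectralDecomposition P κ lam φ)
    (hκ : Measurable (Function.uncurry κ)) :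
    ∀ᵐ x ∂P, MemLp (κ x) 2 P := by
  filter_upwards [(h.memLp_uncurry hκ).integrable_sq.prod_right_ae] with x hx
  exact (memLp_two_iff_integrable_sq (hκ.of_uncurry_left.aestronglyMeasurable)).2 hx

theorem ae_integral_sub_sq [IsProbabilityMeasure P] (h : IsSpectralDecomposition P κ lam φ)
    (hκ : Measurable (Function.uncurry κ)) (s : Finset ι) :
    ∀ᵐ x ∂P, ∫ y, (κ x y - ∑ i ∈ s, lam i * φ i x * φ i y) ^ 2 ∂P
      = ∫ y, κ x y ^ 2 ∂P - ∑ i ∈ s, (lam i * φ i x) ^ 2 := by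
  have h' : ∀ᵐ x ∂P, ∀ i ∈ s, ∫ y, κ x y * φ i y ∂P = lam i * φ i x :=
    (Finset.eventually_all s).2 fun i _ => h.eigen i
  classical
  filter_upwards [h.ae_memLp hκ, h'] with x hx hi
  -- Restricting the index to `s` means that only finitely many null sets of the eigenvalue
  -- equations are used.
  have := integral_sub_sum_sq (φ := fun i : s => φ i) (fun i => h.memLp i) (fun i => h.norm_one i)
    (fun i j hij => h.orthogonal i j fun e => hij (Subtype.ext e)) hx
    (c := fun i => lam i * φ i x) (fun i => hi i i.2) Finset.univ
  rw [← Finset.sum_coe_sort s (fun i => (lam i * φ i x) ^ 2), ← this]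
  refine integral_congr_ae (ae_of_all _ fun y => ?_)
  simp only
  rw [← Finset.sum_coe_sort s (fun i => lam i * φ i x * φ i y)]

theorem ae_sum_sq_le [IsProbabilityMeasure P] (h : IsSpectralDecomposition P κ lam φ)
    (hκ : Measurable (Function.uncurry κ)) (s : Finset ι) :
    ∀ᵐ x ∂P, ∑ i ∈ s, (lam i * φ i x) ^ 2 ≤ ∫ y, κ x y ^ 2 ∂P := by
  filter_upwards [h.ae_integral_sub_sq hκ s] with x hx
  have : 0 ≤ ∫ y, (κ x y - ∑ i ∈ s, lam i * φ i x * φ i y) ^ 2 ∂P :=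
    integral_nonneg fun y => sq_nonneg _
  linarith

theorem lintegral_sub_sq [IsProbabilityMeasure P] (h : IsSpectralDecomposition P κ lam φ)
    (hκ : Measurable (Function.uncurry κ)) (s : Finset ι) :
    ∫⁻ p, ‖κ p.1 p.2 - ∑ i ∈ s, lam i * φ i p.1 * φ i p.2‖ₑ ^ 2 ∂(P.prod P)
      = ENNReal.ofReal (∫ x, ∫ y, κ x y ^ 2 ∂P ∂P - ∑ i ∈ s, lam i ^ 2) := by
  have hL := (h.memLp_uncurry hκ).sub (h.memLp_partialSum s)
  have e : ∀ p : α × α, ‖κ p.1 p.2 - ∑ i ∈ s, lam i * φ i p.1 * φ i p.2‖ₑ ^ 2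
      = ENNReal.ofReal ((κ p.1 p.2 - ∑ i ∈ s, lam i * φ i p.1 * φ i p.2) ^ 2) := fun p => by
    rw [← Real.enorm_of_nonneg (sq_nonneg _), enorm_pow]
  simp_rw [e]
  have hI2 : Integrable (fun p : α × α =>
      (κ p.1 p.2 - ∑ i ∈ s, lam i * φ i p.1 * φ i p.2) ^ 2) (P.prod P) := hL.integrable_sq
  rw [← ofReal_integral_eq_lintegral_ofReal hI2 (ae_of_all _ fun p => sq_nonneg _),
    integral_prod _ hI2, integral_congr_ae (h.ae_integral_sub_sq hκ s), integral_sub]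
  · rw [integral_finsetSum _ fun i _ => ?_]
    · simp_rw [mul_pow, integral_const_mul, h.norm_one, mul_one]
    · simp_rw [mul_pow]
      exact (h.memLp i).integrable_sq.const_mul _
  · exact (h.memLp_uncurry hκ).integrable_sq.integral_prod_left
  · simp_rw [mul_pow]
    exact integrable_finsetSum _ fun i _ => (h.memLp i).integrable_sq.const_mul _

theorem sum_sq_le [IsProbabilityMeasure P] (h : IsSpectralDecomposition P κ lam φ)
    (hκ : Measurable (Function.uncurry κ)) (s : Finset ι) :
    ∑ i ∈ s, lam i ^ 2 ≤ ∫ x, ∫ y, κ x y ^ 2 ∂P ∂P := by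
  have h1 : Integrable (fun x => ∑ i ∈ s, (lam i * φ i x) ^ 2) P := by
    simp_rw [mul_pow]
    exact integrable_finsetSum _ fun i _ => (h.memLp i).integrable_sq.const_mul _
  have := integral_mono_ae h1 (h.memLp_uncurry hκ).integrable_sq.integral_prod_left
    (h.ae_sum_sq_le hκ s)
  refine le_trans (le_of_eq ?_) this
  simp_rw [mul_pow]
  rw [integral_finsetSum _ fun i _ => (h.memLp i).integrable_sq.const_mul _]
  simp_rw [integral_const_mul, h.norm_one, mul_one]

theorem exists_lt_sum_sq [IsProbabilityMeasure P] (h : IsSpectralDecomposition P κ lam φ)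
    (hκ : Measurable (Function.uncurry κ)) {r : ℝ} (hr : r < ∫ x, ∫ y, κ x y ^ 2 ∂P ∂P) :
    ∃ s : Finset ι, r < ∑ i ∈ s, lam i ^ 2 := by
  have hpos : (0 : ℝ≥0∞) < ENNReal.ofReal (∫ x, ∫ y, κ x y ^ 2 ∂P ∂P - r) := by simpa using hr
  obtain ⟨s, hs⟩ := (h.expansion.eventually (gt_mem_nhds hpos)).exists
  rw [h.lintegral_sub_sq hκ, ENNReal.ofReal_lt_ofReal_iff (by linarith)] at hs
  exact ⟨s, by linarith⟩

/-- Integrating the eigenvalue equation and using that `κ` is centered gives this. An eigenfunction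
with eigenvalue 0 need not be centered, but it always enters with the factor `lam i`. -/
theorem eigenvalue_mul_integral_eq_zero [IsProbabilityMeasure P]
    (h : IsSpectralDecomposition P κ lam φ)
    (hκ : Measurable (Function.uncurry κ)) (h0 : ∀ y, ∫ x, κ x y ∂P = 0) (i : ι) :
    lam i * ∫ x, φ i x ∂P = 0 := by
  have hI : Integrable (Function.uncurry fun x y => κ x y * φ i y) (P.prod P) :=
    (h.memLp_uncurry hκ).integrable_mul ((h.memLp i).comp_snd P)
  rw [← integral_const_mul, ← integral_congr_ae (h.eigen i), integral_integral_swap hI]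
  simp_rw [integral_mul_const, h0]
  simp

end IsSpectralDecomposition

/-! ### Centered kernels and the weights of the witness function. -/

section Centered

variable {k : α → α → ℝ}

theorem IsPosDefKernel.symm {β : Type*} {k : β → β → ℝ} (hk : IsPosDefKernel k) (x y : β) :
    k x y = k y x := by
  have := (hk 2 ![x, y]).1.apply 1 0
  simpa using this

theorem IsPosDefKernel.self_nonneg {β : Type*} {k : β → β → ℝ} (hk : IsPosDefKernel k) (x : β) :
    0 ≤ k x x := by
  have := (hk 1 ![x]).diag_nonneg (i := 0)
  simpa using this

theorem IsPosDefKernel.abs_le {β : Type*} {k : β → β → ℝ} (hk : IsPosDefKernel k) (x y : β) :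
    |k x y| ≤ Real.sqrt (k x x) * Real.sqrt (k y y) := by
  have h := (hk 2 ![x, y]).det_nonneg
  rw [Matrix.det_fin_two] at h
  simp only [Matrix.of_apply, Matrix.cons_val_zero, Matrix.cons_val_one] at h
  rw [hk.symm y x] at h
  rw [← Real.sqrt_mul (hk.self_nonneg x)]
  exact Real.abs_le_sqrt (by nlinarith)

theorem measurable_centeredKernel [IsProbabilityMeasure P] (hk : Measurable (Function.uncurry k)) :
    Measurable (Function.uncurry (centeredKernel P k)) := by
  have h1 : Measurable fun x => ∫ b, k x b ∂P :=
    (StronglyMeasurable.integral_prod_right (f := k) hk.stronglyMeasurable).measurable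
  have h2 : Measurable fun y => ∫ a, k a y ∂P :=
    (StronglyMeasurable.integral_prod_left (f := k) hk.stronglyMeasurable).measurable
  exact ((hk.sub (h1.comp measurable_fst)).sub (h2.comp measurable_snd)).add_const _

theorem integrable_uncurry_kernel (hk : Measurable (Function.uncurry k)) (hp : IsPosDefKernel k)
    (hi : Integrable (fun x => Real.sqrt (k x x)) P) :
    Integrable (Function.uncurry k) (P.prod P) :=
  (hi.mul_prod hi).mono' hk.aestronglyMeasurable (ae_of_all _ fun p => hp.abs_le p.1 p.2)

theorem integral_centeredKernel_right [IsProbabilityMeasure P]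
    (hk : Measurable (Function.uncurry k))
    (hp : IsPosDefKernel k) (hi : Integrable (fun x => Real.sqrt (k x x)) P) (x : α) :
    ∫ y, centeredKernel P k x y ∂P = 0 := by
  have hI := integrable_uncurry_kernel hk hp hi
  have h1 : Integrable (fun y => k x y) P :=
    (hi.const_mul (Real.sqrt (k x x))).mono' hk.of_uncurry_left.aestronglyMeasurable
      (ae_of_all _ fun y => hp.abs_le x y)
  have h2 : Integrable (fun y => ∫ a, k a y ∂P) P := hI.integral_prod_right
  have h12 : Integrable (fun y => k x y - ∫ b, k x b ∂P) P := h1.sub (integrable_const _)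
  have h123 : Integrable (fun y => k x y - (∫ b, k x b ∂P) - ∫ a, k a y ∂P) P := h12.sub h2
  unfold centeredKernel
  rw [integral_add h123 (integrable_const _), integral_sub h12 h2,
    integral_sub h1 (integrable_const _), integral_integral_swap hI]
  simp

theorem centeredKernel_symm (hp : IsPosDefKernel k) (x y : α) :
    centeredKernel P k x y = centeredKernel P k y x := by
  unfold centeredKernel
  simp_rw [hp.symm x, fun a => hp.symm a y]
  ring

theorem integral_centeredKernel_left [IsProbabilityMeasure P] (hk : Measurable (Function.uncurry k))
    (hp : IsPosDefKernel k) (hi : Integrable (fun x => Real.sqrt (k x x)) P) (y : α) :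
    ∫ x, centeredKernel P k x y ∂P = 0 := by
  simp_rw [fun x => centeredKernel_symm (P := P) hp x y]
  exact integral_centeredKernel_right hk hp hi y

/-- The weights of the observations of the two samples in the witness function. -/
noncomputable def witnessWeight (n₁ n₂ : ℕ) : Fin n₁ ⊕ Fin n₂ → ℝ :=
  Sum.elim (fun _ => (n₁ : ℝ)⁻¹) (fun _ => -(n₂ : ℝ)⁻¹)

/-- The weights sum to zero, which needs both samples nonempty. This cancels the centering terms
that do not involve `z`; the remaining ones do not depend on `x` and form `c`. -/
theorem witness_eq_sum_centeredKernel {n₁ n₂ : ℕ} (h₁ : n₁ ≠ 0) (h₂ : n₂ ≠ 0) (P : Measure α)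
    (k : α → α → ℝ) (z : Fin n₁ ⊕ Fin n₂ → α) :
    ∃ c : ℝ, ∀ x, witness k (MeasurableEquiv.sumPiEquivProdPi (fun _ => α) z) x
      = ∑ j, witnessWeight n₁ n₂ j * centeredKernel P k (z j) x + c := by
  have h₁' : (n₁ : ℝ) ≠ 0 := by exact_mod_cast h₁
  have h₂' : (n₂ : ℝ) ≠ 0 := by exact_mod_cast h₂
  refine ⟨(n₁ : ℝ)⁻¹ * ∑ i, ∫ b, k (z (Sum.inl i)) b ∂P
    - (n₂ : ℝ)⁻¹ * ∑ i, ∫ b, k (z (Sum.inr i)) b ∂P, fun x => ?_⟩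
  simp only [witness, witnessWeight, centeredKernel, Fintype.sum_sum_type, Sum.elim_inl,
    Sum.elim_inr, MeasurableEquiv.coe_sumPiEquivProdPi, Equiv.sumPiEquivProdPi, Equiv.coe_fn_mk,
    ← Finset.mul_sum, Finset.sum_add_distrib, Finset.sum_sub_distrib, Finset.sum_const,
    Finset.card_univ, Fintype.card_fin, nsmul_eq_mul]
  field_simp
  ring

theorem sum_sq_witnessWeight (n₁ n₂ : ℕ) (h₁ : n₁ ≠ 0) (h₂ : n₂ ≠ 0) :
    ∑ j, witnessWeight n₁ n₂ j ^ 2 = (n₁ : ℝ)⁻¹ + (n₂ : ℝ)⁻¹ := by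
  have h₁' : (n₁ : ℝ) ≠ 0 := by exact_mod_cast h₁
  have h₂' : (n₂ : ℝ) ≠ 0 := by exact_mod_cast h₂
  simp [witnessWeight]
  field_simp

theorem sum_pow_four_witnessWeight_le (n₁ n₂ : ℕ) (h₁ : n₁ ≠ 0) (h₂ : n₂ ≠ 0) :
    ∑ j, witnessWeight n₁ n₂ j ^ 4
      ≤ (∑ j, witnessWeight n₁ n₂ j ^ 2) ^ 2 * ((n₁ : ℝ)⁻¹ + (n₂ : ℝ)⁻¹) := by
  have h₁' : (n₁ : ℝ) ≠ 0 := by exact_mod_cast h₁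
  have h₂' : (n₂ : ℝ) ≠ 0 := by exact_mod_cast h₂
  have e : ∑ j, witnessWeight n₁ n₂ j ^ 4 = (n₁ : ℝ)⁻¹ ^ 3 + (n₂ : ℝ)⁻¹ ^ 3 := by
    simp [witnessWeight, Even.neg_pow (show Even 4 by decide)]
    field_simp
  rw [e, sum_sq_witnessWeight n₁ n₂ h₁ h₂]
  have p : 0 ≤ (n₁ : ℝ)⁻¹ := by positivity
  have q : 0 ≤ (n₂ : ℝ)⁻¹ := by positivity
  nlinarith [mul_nonneg p q, mul_nonneg (mul_nonneg p q) p, mul_nonneg (mul_nonneg p q) q]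

end Centered

end Kernel

/-! ### Lower bound on the variance of the witness. -/

section QuadraticForm

open scoped RealInnerProductSpace

variable {α : Type*} [MeasurableSpace α] {P : Measure α} [IsProbabilityMeasure P]
  {J : Type*} [Fintype J]

theorem ae_pi_forall {p : α → Prop} (hp : ∀ᵐ x ∂P, p x) :
    ∀ᵐ z ∂(Measure.pi fun _ : J => P), ∀ j, p (z j) :=
  ae_all_iff.2 fun j =>
    (measurePreserving_eval (fun _ : J => P) j).quasiMeasurePreserving.tendsto_ae.eventually hp

variable {ι : Type*} {κ : α → α → ℝ} {lam : ι → ℝ} {φ : ι → α → ℝ}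

namespace IsSpectralDecomposition

/-- Bessel's inequality for a linear combination of kernel sections. -/
theorem ae_sum_sq_le_variance [Countable ι] (h : IsSpectralDecomposition P κ lam φ)
    (hκ : Measurable (Function.uncurry κ)) (h0 : ∀ x, ∫ y, κ x y ∂P = 0) (a : J → ℝ)
    (s : Finset ι) :
    ∀ᵐ z ∂(Measure.pi fun _ : J => P), ∀ c : ℝ,
      ∑ i ∈ s, (lam i * ∑ j, a j * φ i (z j)) ^ 2
        ≤ variance (fun x => ∑ j, a j * κ (z j) x + c) P := by
  -- The exceptional set must not depend on `c`, because the additive constant of the witness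
  -- depends on `z`.
  filter_upwards [ae_pi_forall (J := J) (h.ae_memLp hκ),
    ae_pi_forall (J := J) (ae_all_iff.2 h.eigen)] with z hz hi c
  have hg : MemLp (fun x => ∑ j, a j * κ (z j) x) 2 P :=
    memLp_finsetSum _ fun j _ => (hz j).const_mul _
  have hint : ∀ j, Integrable (fun x => a j * κ (z j) x) P := fun j =>
    ((hz j).const_mul _).integrable (by norm_num)
  have hg0 : ∫ x, ∑ j, a j * κ (z j) x ∂P = 0 := by
    rw [integral_finsetSum _ fun j _ => hint j]
    simp_rw [integral_const_mul, h0]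
    simp
  have hc : ∀ i, ∫ x, (∑ j, a j * κ (z j) x) * φ i x ∂P = lam i * ∑ j, a j * φ i (z j) := by
    intro i
    have hI : ∀ j, Integrable (fun x => κ (z j) x * φ i x) P := fun j =>
      (hz j).integrable_mul (h.memLp i)
    simp_rw [Finset.sum_mul, mul_assoc]
    rw [integral_finsetSum _ fun j _ => (hI j).const_mul _]
    simp_rw [integral_const_mul, hi, Finset.mul_sum]
    exact Finset.sum_congr rfl fun j _ => by ring
  have hB := integral_sub_sum_sq h.memLp h.norm_one h.orthogonal hg hc s
  rw [variance_add_const hg.1, variance_of_integral_eq_zero hg.1.aemeasurable hg0]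
  have : 0 ≤ ∫ x, (∑ j, a j * κ (z j) x
      - ∑ i ∈ s, (lam i * ∑ j, a j * φ i (z j)) * φ i x) ^ 2 ∂P :=
    integral_nonneg fun x => sq_nonneg _
  linarith

/-- The quadratic form that bounds the variance of the witness function from below is not too
concentrated at `0`. -/
theorem measure_sum_sq_le (h : IsSpectralDecomposition P κ lam φ)
    (hκ : Measurable (Function.uncurry κ)) (h0 : ∀ y, ∫ x, κ x y ∂P = 0)
    {σ : ℝ} (hσ0 : 0 < σ) (hG : Integrable (fun x => (∫ y, κ x y ^ 2 ∂P) ^ 2) P)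
    {s : Finset ι} (hs : σ / 2 ≤ ∑ i ∈ s, lam i ^ 2)
    {a : J → ℝ} (hA : 0 < ∑ j, a j ^ 2) {u : ℝ} (hu : 0 < u) :
    (Measure.pi fun _ : J => P).real
        {z | ∑ i ∈ s, (lam i * ∑ j, a j * φ i (z j)) ^ 2 ≤ (∑ j, a j ^ 2) * σ / u}
      ≤ Real.exp (1 / 2) * (Real.exp 1 * (Real.sqrt (1 + u / 2))⁻¹
        + 6 * gaussianFourthMoment * u ^ 2 * ((∑ j, a j ^ 4) / (∑ j, a j ^ 2) ^ 2)
          * (∫ x, (∫ y, κ x y ^ 2 ∂P) ^ 2 ∂P) / σ ^ 2) := by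
  set A := ∑ j, a j ^ 2
  have hφm := h.measurable
  let b : α → EuclideanSpace ℝ s := fun x => WithLp.toLp 2 fun i => lam i * φ i x
  have hb : Measurable b := by fun_prop
  have hin : ∀ ξ x, ⟪ξ, b x⟫ = ∑ i : s, lam i * ξ i * φ i x := fun ξ x => by
    simp only [PiLp.inner_apply, b, RCLike.inner_apply, conj_trivial]
    exact Finset.sum_congr rfl fun i _ => by ring
  have hbn : ∀ x, ‖b x‖ ^ 2 = ∑ i ∈ s, (lam i * φ i x) ^ 2 := fun x => by
    rw [EuclideanSpace.real_norm_sq_eq, ← Finset.sum_coe_sort s fun i => (lam i * φ i x) ^ 2]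
  have hφI : ∀ i : s, Integrable (φ i) P := fun i => (h.memLp i).integrable (by norm_num)
  have hb0 : ∀ ξ, ∫ x, ⟪ξ, b x⟫ ∂P = 0 := fun ξ => by
    simp_rw [hin]
    rw [integral_finsetSum _ fun i _ => (hφI i).const_mul _]
    refine Finset.sum_eq_zero fun i _ => ?_
    rw [integral_const_mul, mul_right_comm, h.eigenvalue_mul_integral_eq_zero hκ h0, zero_mul]
  -- Bessel bounds `‖b x‖` independently of the truncation `s`.
  have hb4le : ∀ᵐ x ∂P, ‖b x‖ ^ 4 ≤ (∫ y, κ x y ^ 2 ∂P) ^ 2 := by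
    filter_upwards [h.ae_sum_sq_le hκ s] with x hx
    rw [← hbn] at hx
    calc ‖b x‖ ^ 4 = (‖b x‖ ^ 2) ^ 2 := by ring
      _ ≤ _ := by gcongr
  have hb4 : Integrable (fun x => ‖b x‖ ^ 4) P := by
    refine hG.mono' (by fun_prop) ?_
    filter_upwards [hb4le] with x hx
    rwa [Real.norm_eq_abs, abs_of_nonneg (by positivity)]
  have hb2 : ∀ ξ, ∫ x, ⟪ξ, b x⟫ ^ 2 ∂P = ∑ i : s, lam i ^ 2 * ξ i ^ 2 := fun ξ => by
    have := integral_sum_mul_sq (φ := fun i : s => φ i) (fun i => h.memLp i)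
      (fun i => h.norm_one i) (fun i j hij => h.orthogonal i j fun e => hij (Subtype.ext e))
      (fun i => lam i * ξ i) Finset.univ
    simpa only [hin, mul_pow] using this
  have hu' : 0 < u / (A * σ) := by positivity
  -- With this scale, the event `‖v‖² ≤ A * σ / u` is the event that the exponent `t² ‖v‖² / 2` is
  -- at most `1 / 2`.
  set t := Real.sqrt (u / (A * σ))
  have ht : t ^ 2 = u / (A * σ) := Real.sq_sqrt hu'.le
  have hmain := integral_exp_neg_sq_norm_sum_le a hb hb0 hb4 t
  have hQ : ∀ z : J → α, ‖∑ j, a j • b (z j)‖ ^ 2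
      = ∑ i ∈ s, (lam i * ∑ j, a j * φ i (z j)) ^ 2 := fun z => by
    rw [EuclideanSpace.real_norm_sq_eq,
      ← Finset.sum_coe_sort s fun i => (lam i * ∑ j, a j * φ i (z j)) ^ 2]
    refine Finset.sum_congr rfl fun i _ => ?_
    congr 1
    simp only [WithLp.ofLp_sum, WithLp.ofLp_smul, Finset.sum_apply, Pi.smul_apply, smul_eq_mul, b,
      Finset.mul_sum]
    exact Finset.sum_congr rfl fun j _ => by ring
  have hv : Measurable fun z : J → α => ∑ j, a j • b (z j) :=
    Finset.measurable_sum _ fun j _ => by fun_prop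
  have hmark := mul_meas_ge_le_integral_of_nonneg (μ := Measure.pi fun _ : J => P)
    (f := fun z => Real.exp (-(t ^ 2 / 2 * ‖∑ j, a j • b (z j)‖ ^ 2)))
    (ae_of_all _ fun z => (Real.exp_pos _).le)
    ((integrable_const (1 : ℝ)).mono' (Real.measurable_exp.comp
      ((hv.norm.pow_const 2).const_mul _).neg).aestronglyMeasurable (ae_of_all _ fun z => by
      rw [Real.norm_eq_abs, Real.abs_exp]
      exact Real.exp_le_one_iff.2 (neg_nonpos.2 (by positivity)))) (Real.exp (-(1 / 2)))
  have hset : {z : J → α | ∑ i ∈ s, (lam i * ∑ j, a j * φ i (z j)) ^ 2 ≤ A * σ / u}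
      ⊆ {z | Real.exp (-(1 / 2)) ≤ Real.exp (-(t ^ 2 / 2 * ‖∑ j, a j • b (z j)‖ ^ 2))} := by
    intro z hz
    rw [Set.mem_ofPred_eq] at hz ⊢
    rw [hQ, ht]
    refine Real.exp_le_exp.2 (neg_le_neg ?_)
    calc _ ≤ u / (A * σ) / 2 * (A * σ / u) := by gcongr
      _ = 1 / 2 := by field_simp
  have hγ : ∫ ξ, Real.exp (-(t ^ 2 * A / 2 * ∫ x, ⟪ξ, b x⟫ ^ 2 ∂P))
      ∂(stdGaussian (EuclideanSpace ℝ s)) ≤ (Real.sqrt (1 + u / 2))⁻¹ := by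
    -- The truncated spectrum carries at least half of `σ`; this yields `1 + 2 * (u / 4) = 1 + u /
    -- 2` under the root.
    have hW : u / 4 ≤ ∑ i : s, u / (2 * σ) * lam i ^ 2 := by
      rw [← Finset.mul_sum, Finset.sum_coe_sort s fun i => lam i ^ 2]
      calc u / 4 = u / (2 * σ) * (σ / 2) := by field_simp; norm_num
        _ ≤ _ := by gcongr
    have e : ∀ ξ, t ^ 2 * A / 2 * ∫ x, ⟪ξ, b x⟫ ^ 2 ∂P
        = ∑ i : s, u / (2 * σ) * lam i ^ 2 * ξ i ^ 2 := fun ξ => by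
      rw [hb2, ht, Finset.mul_sum]
      exact Finset.sum_congr rfl fun i _ => by field_simp
    simp_rw [e]
    refine (integral_exp_neg_sum_sq_stdGaussian_le (fun i => by positivity)
      (lt_of_lt_of_le (by positivity) hW)).trans ?_
    gcongr
    linarith
  have hA4 : 0 ≤ ∑ j, a j ^ 4 := Finset.sum_nonneg fun j _ => by positivity
  have hb4G : ∫ x, ‖b x‖ ^ 4 ∂P ≤ ∫ x, (∫ y, κ x y ^ 2 ∂P) ^ 2 ∂P := integral_mono_ae hb4 hG hb4le
  have hG0 := gaussianFourthMoment_nonneg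
  have ht4 : t ^ 4 = u ^ 2 / (A * σ) ^ 2 := by
    rw [show t ^ 4 = (t ^ 2) ^ 2 by ring, ht, div_pow]
  calc _ ≤ (Measure.pi fun _ : J => P).real
        {z | Real.exp (-(1 / 2)) ≤ Real.exp (-(t ^ 2 / 2 * ‖∑ j, a j • b (z j)‖ ^ 2))} :=
        measureReal_mono hset
    _ = Real.exp (1 / 2) * (Real.exp (-(1 / 2)) * (Measure.pi fun _ : J => P).real
        {z | Real.exp (-(1 / 2)) ≤ Real.exp (-(t ^ 2 / 2 * ‖∑ j, a j • b (z j)‖ ^ 2))}) := by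
        rw [← mul_assoc, ← Real.exp_add]; simp
    _ ≤ Real.exp (1 / 2) * (Real.exp 1 * (Real.sqrt (1 + u / 2))⁻¹
          + 6 * t ^ 4 * (∑ j, a j ^ 4)
            * (gaussianFourthMoment * ∫ x, (∫ y, κ x y ^ 2 ∂P) ^ 2 ∂P)) := by
        refine mul_le_mul_of_nonneg_left (hmark.trans (hmain.trans ?_)) (Real.exp_pos _).le
        gcongr
    _ = _ := by
        rw [ht4]
        congr 2
        field_simp

end IsSpectralDecomposition

end QuadraticForm

/-! ### Linearity and continuity of the regression error. -/

section Residual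

theorem ae_tendsto_zero_of_tsum_lintegral_ne_top {α : Type*} [MeasurableSpace α] {μ : Measure α}
    {h : ℕ → α → ℝ} (hm : ∀ n, AEStronglyMeasurable (h n) μ)
    (hs : ∑' n, ∫⁻ x, ‖h n x‖ₑ ∂μ ≠ ∞) : ∀ᵐ x ∂μ, Tendsto (fun n => h n x) atTop (𝓝 0) := by
  rw [← lintegral_tsum fun n => (hm n).enorm] at hs
  filter_upwards [ae_lt_top' (AEMeasurable.tsum fun n => (hm n).enorm) hs] with x hx
  have := ENNReal.tendsto_atTop_zero_of_tsum_ne_top hx.ne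
  rw [tendsto_zero_iff_norm_tendsto_zero]
  simpa [Function.comp_def, toReal_enorm] using
    (ENNReal.tendsto_toReal ENNReal.zero_ne_top).comp this

namespace LinearSmoother

variable {K 𝒳 𝒱 : Type*} [Fintype K] [MeasurableSpace 𝒳] [MeasurableSpace 𝒱]

/-- The error `E[g(X) | V] - Ê[g(X) | V]` as a function of the training sample and of the new
observation. -/
noncomputable def residual (S : LinearSmoother K 𝒳 𝒱) (ρ : Measure (𝒳 × 𝒱)) (g : 𝒳 → ℝ)
    (q : (K → 𝒳 × 𝒱) × (𝒳 × 𝒱)) : ℝ :=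
  (ρ[fun p : 𝒳 × 𝒱 => g p.1 | MeasurableSpace.comap Prod.snd inferInstance]) q.2 -
    S.estimate g q.1 q.2.2

variable (S : LinearSmoother K 𝒳 𝒱) (ρ : Measure (𝒳 × 𝒱))

theorem condMSE_eq_lintegral_residual (g : 𝒳 → ℝ) :
    S.condMSE ρ g = ∫⁻ q, ‖S.residual ρ g q‖ₑ ^ 2 ∂((Measure.pi fun _ : K => ρ).prod ρ) := rfl

theorem measurable_residual {g : 𝒳 → ℝ} (hg : Measurable g) : Measurable (S.residual ρ g) := by
  have h1 : Measurable
      (ρ[fun p : 𝒳 × 𝒱 => g p.1 | MeasurableSpace.comap Prod.snd inferInstance]) :=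
    (stronglyMeasurable_condExp.mono measurable_snd.comap_le).measurable
  have h2 : Measurable fun q : (K → 𝒳 × 𝒱) × (𝒳 × 𝒱) => S.estimate g q.1 q.2.2 := by
    unfold estimate
    refine Finset.measurable_sum _ fun j _ => Measurable.mul ?_ (by fun_prop)
    exact (S.measurable_weight j).comp
      (measurable_fst.prodMk (measurable_snd.comp measurable_snd))
  exact (h1.comp measurable_snd).sub h2

theorem ae_snd_of_ae {p : 𝒳 × 𝒱 → Prop} (hp : ∀ᵐ x ∂ρ, p x) :
    ∀ᵐ q ∂((Measure.pi fun _ : K => ρ).prod ρ), p q.2 :=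
  Measure.quasiMeasurePreserving_snd.tendsto_ae.eventually hp

theorem integrable_comp_fst {g : 𝒳 → ℝ} (hg : Integrable g ρ.fst) :
    Integrable (fun p : 𝒳 × 𝒱 => g p.1) ρ :=
  hg.comp_measurable measurable_fst

theorem residual_sum {ι : Type*} (s : Finset ι) (c : ι → ℝ) {g : ι → 𝒳 → ℝ}
    (hg : ∀ i ∈ s, Integrable (g i) ρ.fst) :
    ∀ᵐ q ∂((Measure.pi fun _ : K => ρ).prod ρ),
      S.residual ρ (fun x => ∑ i ∈ s, c i * g i x) q = ∑ i ∈ s, c i * S.residual ρ (g i) q := by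
  have h1 := condExp_finsetSum (μ := ρ) (s := s) (f := fun i => c i • fun p : 𝒳 × 𝒱 => g i p.1)
    (fun i hi => (integrable_comp_fst ρ (hg i hi)).smul (c i))
    (MeasurableSpace.comap Prod.snd inferInstance)
  have h2 : ∀ᵐ p ∂ρ, ∀ i ∈ s, (ρ[c i • fun p : 𝒳 × 𝒱 => g i p.1 |
      MeasurableSpace.comap Prod.snd inferInstance]) p
      = c i * (ρ[fun p : 𝒳 × 𝒱 => g i p.1 | MeasurableSpace.comap Prod.snd inferInstance]) p :=
    (Finset.eventually_all s).2 fun i _ => condExp_smul (c i) _ _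
  filter_upwards [ae_snd_of_ae (K := K) ρ h1, ae_snd_of_ae (K := K) ρ h2] with q hq1 hq2
  have e : (fun p : 𝒳 × 𝒱 => ∑ i ∈ s, c i * g i p.1)
      = ∑ i ∈ s, c i • fun p : 𝒳 × 𝒱 => g i p.1 := by
    ext p; simp
  unfold residual
  rw [e, hq1, Finset.sum_apply, Finset.sum_congr rfl hq2]
  simp only [mul_sub, Finset.sum_sub_distrib, estimate]
  congr 1
  simp_rw [Finset.mul_sum]
  rw [Finset.sum_comm]
  exact Finset.sum_congr rfl fun i _ => Finset.sum_congr rfl fun j _ => by ring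

variable {S ρ} [IsProbabilityMeasure ρ]

theorem AffineEquivariant.residual_add_const (hS : S.AffineEquivariant ρ) {g : 𝒳 → ℝ}
    (hgm : Measurable g) (hg : Integrable g ρ.fst) (c : ℝ) :
    ∀ᵐ q ∂((Measure.pi fun _ : K => ρ).prod ρ),
      S.residual ρ (fun x => g x + c) q = S.residual ρ g q := by
  have h1 := condExp_add (integrable_comp_fst ρ hg) (integrable_const c)
    (MeasurableSpace.comap (Prod.snd : 𝒳 × 𝒱 → 𝒱) inferInstance)
  rw [condExp_const measurable_snd.comap_le] at h1
  have hmp : MeasurePreserving (Prod.map id Prod.snd : (K → 𝒳 × 𝒱) × (𝒳 × 𝒱) → (K → 𝒳 × 𝒱) × 𝒱)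
      ((Measure.pi fun _ : K => ρ).prod ρ) ((Measure.pi fun _ : K => ρ).prod ρ.snd) :=
    (MeasurePreserving.id _).prod ⟨measurable_snd, rfl⟩
  have h2 := hmp.quasiMeasurePreserving.tendsto_ae.eventually (hS g hgm 1 c)
  filter_upwards [ae_snd_of_ae (K := K) ρ h1, h2] with q hq1 hq2
  simp only [one_mul, Prod.map_fst, Prod.map_snd, id] at hq2
  have e : (fun p : 𝒳 × 𝒱 => g p.1 + c) = (fun p : 𝒳 × 𝒱 => g p.1) + fun _ => c := rfl
  unfold residual
  rw [e, hq1, hq2, Pi.add_apply]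
  ring

variable (S)

/-- The smoother needs pointwise convergence at the training points, while the conditional
expectation is only controlled in `L¹`, where it is a contraction. Summable `L¹` errors give almost
sure convergence of both. -/
theorem ae_tendsto_residual {g : ℕ → 𝒳 → ℝ} {f : 𝒳 → ℝ} (hg : ∀ n, Integrable (g n) ρ.fst)
    (hf : Integrable f ρ.fst) (hs : ∑' n, ∫⁻ x, ‖g n x - f x‖ₑ ∂ρ.fst ≠ ∞) :
    ∀ᵐ q ∂((Measure.pi fun _ : K => ρ).prod ρ),
      Tendsto (fun n => S.residual ρ (g n) q) atTop (𝓝 (S.residual ρ f q)) := by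
  have h1 : ∀ᵐ x ∂ρ.fst, Tendsto (fun n => g n x) atTop (𝓝 (f x)) := by
    filter_upwards [ae_tendsto_zero_of_tsum_lintegral_ne_top
      (fun n => ((hg n).sub hf).aestronglyMeasurable) hs] with x hx
    exact tendsto_sub_nhds_zero_iff.1 hx
  have h1' : ∀ᵐ p ∂ρ, Tendsto (fun n => g n p.1) atTop (𝓝 (f p.1)) :=
    ae_of_ae_map measurable_fst.aemeasurable h1
  have h2 : ∀ᵐ q ∂((Measure.pi fun _ : K => ρ).prod ρ),
      ∀ j, Tendsto (fun n => g n (q.1 j).1) atTop (𝓝 (f (q.1 j).1)) :=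
    Measure.quasiMeasurePreserving_fst.tendsto_ae.eventually (ae_pi_forall h1')
  have h3 : ∀ᵐ p ∂ρ, Tendsto (fun n => (ρ[(fun p : 𝒳 × 𝒱 => g n p.1) - fun p => f p.1 |
      MeasurableSpace.comap Prod.snd inferInstance]) p) atTop (𝓝 0) := by
    refine ae_tendsto_zero_of_tsum_lintegral_ne_top
      (fun n => (stronglyMeasurable_condExp.mono measurable_snd.comap_le).aestronglyMeasurable)
      (ne_top_of_le_ne_top hs (ENNReal.tsum_le_tsum fun n => ?_))
    have := eLpNorm_condExp_le_eLpNorm (μ := ρ) (p := 1)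
      (m := MeasurableSpace.comap Prod.snd inferInstance)
      ((fun p : 𝒳 × 𝒱 => g n p.1) - fun p => f p.1) le_rfl
    simp only [eLpNorm_one_eq_lintegral_enorm] at this
    refine this.trans (le_of_eq ?_)
    rw [Measure.fst, lintegral_map' ?_ measurable_fst.aemeasurable]
    · rfl
    · exact ((hg n).sub hf).aestronglyMeasurable.enorm
  have h4 : ∀ᵐ p ∂ρ, ∀ n, (ρ[(fun p : 𝒳 × 𝒱 => g n p.1) - fun p => f p.1 |
      MeasurableSpace.comap Prod.snd inferInstance]) p
      = (ρ[fun p : 𝒳 × 𝒱 => g n p.1 | MeasurableSpace.comap Prod.snd inferInstance]) p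
        - (ρ[fun p : 𝒳 × 𝒱 => f p.1 | MeasurableSpace.comap Prod.snd inferInstance]) p :=
    ae_all_iff.2 fun n => condExp_sub (integrable_comp_fst ρ (hg n)) (integrable_comp_fst ρ hf) _
  filter_upwards [h2, ae_snd_of_ae (K := K) ρ h3, ae_snd_of_ae (K := K) ρ h4] with q hq2 hq3 hq4
  refine Tendsto.sub ?_ (tendsto_finsetSum _ fun j _ => (hq2 j).const_mul _)
  simp_rw [hq4] at hq3
  exact tendsto_sub_nhds_zero_iff.1 hq3

end LinearSmoother

end Residual

/-! ### Upper bound on the expected regression error of the witness. -/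

section UpperBound

theorem lintegral_sq_sum_pi {α : Type*} [MeasurableSpace α] {P : Measure α}
    [IsProbabilityMeasure P] {J : Type*} [Fintype J] (a : J → ℝ) {g : α → ℝ} (hg : MemLp g 2 P)
    (h0 : ∫ x, g x ∂P = 0) :
    ∫⁻ z, ‖∑ j, a j * g (z j)‖ₑ ^ 2 ∂(Measure.pi fun _ : J => P)
      = ENNReal.ofReal ((∑ j, a j ^ 2) * ∫ x, g x ^ 2 ∂P) := by
  have hj : ∀ j, MemLp (fun z : J → α => a j * g (z j)) 2 (Measure.pi fun _ : J => P) := fun j =>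
    (hg.comp_measurePreserving (measurePreserving_eval (fun _ : J => P) j)).const_mul _
  have hL : MemLp (∑ j, fun z : J → α => a j * g (z j)) 2 (Measure.pi fun _ : J => P) :=
    memLp_finsetSum' _ fun j _ => hj j
  have hm : ∫ z, (∑ j, fun z : J → α => a j * g (z j)) z ∂(Measure.pi fun _ : J => P) = 0 := by
    simp only [Finset.sum_apply]
    rw [integral_finsetSum _ fun j _ => (hj j).integrable (by norm_num)]
    refine Finset.sum_eq_zero fun j _ => ?_
    rw [integral_const_mul, integral_comp_eval (μ := fun _ : J => P) hg.1, h0, mul_zero]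
  have hv := variance_sum_pi (μ := fun _ : J => P) (X := fun j x => a j * g x)
    fun j => hg.const_mul (a j)
  rw [variance_of_integral_eq_zero hL.1.aemeasurable hm] at hv
  simp_rw [variance_const_mul, variance_of_integral_eq_zero hg.1.aemeasurable h0] at hv
  rw [Finset.sum_mul, ← hv, ofReal_integral_eq_lintegral_ofReal hL.integrable_sq
    (ae_of_all _ fun z => sq_nonneg _)]
  refine lintegral_congr fun z => ?_
  rw [← Real.enorm_of_nonneg (sq_nonneg _), enorm_pow, Finset.sum_apply]

namespace IsSpectralDecomposition

variable {α : Type*} [MeasurableSpace α] {P : Measure α} [IsProbabilityMeasure P]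
  {ι : Type*} {κ : α → α → ℝ} {lam : ι → ℝ} {φ : ι → α → ℝ}

/-- Along a suitable sequence of partial sums, the expansion of almost every section of the kernel
converges fast in `L¹`. -/
theorem exists_seq_tsum_ne_top (h : IsSpectralDecomposition P κ lam φ)
    (hκ : Measurable (Function.uncurry κ)) :
    ∃ s : ℕ → Finset ι, ∀ᵐ x ∂P,
      ∑' n, ∫⁻ y, ‖∑ i ∈ s n, (lam i * φ i x) * φ i y - κ x y‖ₑ ∂P ≠ ∞ := by
  have hm := h.measurable
  have hmeas : ∀ s : Finset ι, Measurable fun p : α × α =>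
      ∑ i ∈ s, (lam i * φ i p.1) * φ i p.2 - κ p.1 p.2 := fun s =>
    Measurable.sub (by fun_prop) hκ
  have hex : ∀ n : ℕ, ∃ s : Finset ι,
      ∫⁻ p, ‖∑ i ∈ s, (lam i * φ i p.1) * φ i p.2 - κ p.1 p.2‖ₑ ∂(P.prod P)
        ≤ (2⁻¹ : ℝ≥0∞) ^ n := by
    intro n
    -- The expansion controls a squared `L²` error; its root dominates the `L¹` error, which becomes
    -- geometrically summable.
    have hpos : (0 : ℝ≥0∞) < ((2⁻¹ : ℝ≥0∞) ^ n) ^ 2 :=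
      ENNReal.pow_pos (ENNReal.pow_pos (by simp) n) 2
    obtain ⟨s, hs⟩ := (h.expansion.eventually (gt_mem_nhds hpos)).exists
    refine ⟨s, ?_⟩
    have h12 := eLpNorm_le_eLpNorm_of_exponent_le (μ := P.prod P) (p := 1) (q := 2)
      (by norm_num) (hmeas s).aestronglyMeasurable
    rw [eLpNorm_one_eq_lintegral_enorm] at h12
    refine h12.trans ?_
    rw [eLpNorm_eq_lintegral_rpow_enorm_toReal two_ne_zero ENNReal.ofNat_ne_top]
    simp only [ENNReal.toReal_ofNat, ENNReal.rpow_ofNat, one_div]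
    refine (ENNReal.rpow_le_rpow (z := (2⁻¹ : ℝ)) (?_ : _ ≤ ((2⁻¹ : ℝ≥0∞) ^ n) ^ 2)
      (by norm_num)).trans (le_of_eq ?_)
    · refine le_trans (le_of_eq ?_) hs.le
      refine lintegral_congr fun p => ?_
      rw [← enorm_neg, neg_sub]
    · rw [← ENNReal.rpow_natCast, ← ENNReal.rpow_mul]
      norm_num
  choose s hs using hex
  refine ⟨s, ?_⟩
  have hsum : ∫⁻ x, ∑' n, ∫⁻ y, ‖∑ i ∈ s n, (lam i * φ i x) * φ i y - κ x y‖ₑ ∂P ∂P ≠ ∞ := by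
    rw [lintegral_tsum fun n => (hmeas (s n)).enorm.lintegral_prod_right'.aemeasurable]
    refine ne_top_of_le_ne_top ?_ (ENNReal.tsum_le_tsum fun n => ?_)
      (b := ∑' n : ℕ, (2⁻¹ : ℝ≥0∞) ^ n)
    · rw [ENNReal.tsum_geometric, ENNReal.one_sub_inv_two, inv_inv]; simp
    · rw [← lintegral_prod _ (hmeas (s n)).enorm.aemeasurable]
      exact hs n
  filter_upwards [ae_lt_top (Measurable.tsum fun n =>
    (hmeas (s n)).enorm.lintegral_prod_right') hsum] with x hx
  exact hx.ne

/-- For fixed `d`, exchanging sums gives `∑ j, a j * g (z j)` with the single centered function `g =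
∑ i, lam i * d i * φ i`. Independence then produces `∑ a j ^ 2` and orthonormality evaluates `∫ g²`.
-/
theorem lintegral_sum_mul_sq (h : IsSpectralDecomposition P κ lam φ)
    (hκ : Measurable (Function.uncurry κ)) (h0 : ∀ y, ∫ x, κ x y ∂P = 0)
    {J : Type*} [Fintype J] (a : J → ℝ) (s : Finset ι) (d : ι → ℝ) :
    ∫⁻ z, ‖∑ i ∈ s, (lam i * ∑ j, a j * φ i (z j)) * d i‖ₑ ^ 2 ∂(Measure.pi fun _ : J => P)
      = ENNReal.ofReal (∑ j, a j ^ 2) * ∑ i ∈ s, ENNReal.ofReal (lam i ^ 2) * ‖d i‖ₑ ^ 2 := by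
  have hg : MemLp (fun x => ∑ i ∈ s, (lam i * d i) * φ i x) 2 P :=
    memLp_finsetSum _ fun i _ => (h.memLp i).const_mul _
  have hφI : ∀ i, Integrable (φ i) P := fun i => (h.memLp i).integrable (by norm_num)
  have hg0 : ∫ x, ∑ i ∈ s, (lam i * d i) * φ i x ∂P = 0 := by
    rw [integral_finsetSum _ fun i _ => (hφI i).const_mul _]
    refine Finset.sum_eq_zero fun i _ => ?_
    rw [integral_const_mul, mul_right_comm, h.eigenvalue_mul_integral_eq_zero hκ h0, zero_mul]
  have hg2 : ∫ x, (∑ i ∈ s, (lam i * d i) * φ i x) ^ 2 ∂P = ∑ i ∈ s, lam i ^ 2 * d i ^ 2 := by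
    simpa only [mul_pow] using
      integral_sum_mul_sq h.memLp h.norm_one h.orthogonal (fun i => lam i * d i) s
  have e : ∀ z : J → α, ∑ i ∈ s, (lam i * ∑ j, a j * φ i (z j)) * d i
      = ∑ j, a j * ∑ i ∈ s, (lam i * d i) * φ i (z j) := fun z => by
    simp_rw [Finset.mul_sum, Finset.sum_mul]
    rw [Finset.sum_comm]
    exact Finset.sum_congr rfl fun j _ => Finset.sum_congr rfl fun i _ => by ring
  simp_rw [e]
  rw [lintegral_sq_sum_pi a hg hg0, hg2,
    ENNReal.ofReal_mul (Finset.sum_nonneg fun j _ => sq_nonneg _),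
    ENNReal.ofReal_sum_of_nonneg (s := s) fun i _ => by positivity]
  refine congrArg _ (Finset.sum_congr rfl fun i _ => ?_)
  rw [ENNReal.ofReal_mul (sq_nonneg _), ← Real.enorm_of_nonneg (sq_nonneg (d i)), enorm_pow]

end IsSpectralDecomposition

namespace LinearSmoother

variable {K 𝒳 𝒱 : Type*} [Fintype K] [MeasurableSpace 𝒳] [MeasurableSpace 𝒱]
  {S : LinearSmoother K 𝒳 𝒱} {ρ : Measure (𝒳 × 𝒱)} [IsProbabilityMeasure ρ]
  {ι : Type*} {κ : 𝒳 → 𝒳 → ℝ} {lam : ι → ℝ} {φ : ι → 𝒳 → ℝ}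

/-- The mean squared errors for linear combinations of kernel sections at a random sample are
dominated by a function whose expectation is controlled by the mean squared errors for the
eigenfunctions. -/
theorem AffineEquivariant.exists_condMSE_le (hS : S.AffineEquivariant ρ)
    (h : IsSpectralDecomposition ρ.fst κ lam φ)
    (hκ : Measurable (Function.uncurry κ)) (h0 : ∀ y, ∫ x, κ x y ∂ρ.fst = 0)
    {J : Type*} [Fintype J] (a : J → ℝ) :
    ∃ L : (J → 𝒳) → ℝ≥0∞, Measurable L ∧
      (∀ᵐ z ∂(Measure.pi fun _ : J => ρ.fst), ∀ c : ℝ,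
        S.condMSE ρ (fun x => ∑ j, a j * κ (z j) x + c) ≤ L z) ∧
      ∫⁻ z, L z ∂(Measure.pi fun _ : J => ρ.fst)
        ≤ ENNReal.ofReal (∑ j, a j ^ 2) *
          (ENNReal.ofReal (∫ x, ∫ y, κ x y ^ 2 ∂ρ.fst ∂ρ.fst) * ⨆ i, S.condMSE ρ (φ i)) := by
  obtain ⟨s, hs⟩ := h.exists_seq_tsum_ne_top hκ
  set M := (Measure.pi fun _ : K => ρ).prod ρ
  set D : ι → ((K → 𝒳 × 𝒱) × (𝒳 × 𝒱)) → ℝ := fun i => S.residual ρ (φ i)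
  have hD : ∀ i, Measurable (D i) := fun i => S.measurable_residual ρ (h.measurable i)
  have hφ := h.measurable
  have hφI : ∀ i, Integrable (φ i) ρ.fst := fun i => (h.memLp i).integrable (by norm_num)
  set F : ℕ → (J → 𝒳) → ((K → 𝒳 × 𝒱) × (𝒳 × 𝒱)) → ℝ := fun n z q =>
    ∑ i ∈ s n, (lam i * ∑ j, a j * φ i (z j)) * D i q
  have hF : ∀ n, Measurable fun p : (J → 𝒳) × ((K → 𝒳 × 𝒱) × (𝒳 × 𝒱)) => F n p.1 p.2 := fun n =>
    Finset.measurable_sum _ fun i _ => Measurable.mul (by fun_prop) ((hD i).comp measurable_snd)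
  have hFn : ∀ n, Measurable fun z => ∫⁻ q, ‖F n z q‖ₑ ^ 2 ∂M := fun n =>
    Measurable.lintegral_prod_right' (f := fun p => ‖F n p.1 p.2‖ₑ ^ 2) ((hF n).enorm.pow_const 2)
  -- The liminf is measurable in `z`, which is not evident for `condMSE` itself, whose conditional
  -- expectation is chosen separately for each function. Fatou is applied twice: over `q` for the
  -- domination and over `z` for the expectation.
  refine ⟨fun z => liminf (fun n => ∫⁻ q, ‖F n z q‖ₑ ^ 2 ∂M) atTop, .liminf hFn, ?_, ?_⟩
  · filter_upwards [ae_pi_forall (J := J) (h.ae_memLp hκ), ae_pi_forall (J := J) hs]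
      with z hz hzs c
    have hκI : ∀ j, Integrable (κ (z j)) ρ.fst := fun j => (hz j).integrable (by norm_num)
    have hκm : ∀ x, Measurable (κ x) := fun x => hκ.of_uncurry_left
    have h1 := hS.residual_add_const (g := fun x => ∑ j, a j * κ (z j) x)
      (Finset.measurable_sum _ fun j _ => (hκm _).const_mul _)
      (integrable_finsetSum _ fun j _ => (hκI j).const_mul _) c
    have h2 := S.residual_sum ρ Finset.univ a (g := fun j => κ (z j)) fun j _ => hκI j
    have h3 : ∀ᵐ q ∂M, ∀ j, Tendsto (fun n => S.residual ρ
        (fun y => ∑ i ∈ s n, (lam i * φ i (z j)) * φ i y) q) atTop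
          (𝓝 (S.residual ρ (κ (z j)) q)) := ae_all_iff.2 fun j =>
      S.ae_tendsto_residual (fun n => integrable_finsetSum _ fun i _ => (hφI i).const_mul _)
        (hκI j) (hzs j)
    have h4 : ∀ᵐ q ∂M, ∀ j n, S.residual ρ (fun y => ∑ i ∈ s n, (lam i * φ i (z j)) * φ i y) q
        = ∑ i ∈ s n, (lam i * φ i (z j)) * D i q := ae_all_iff.2 fun j => ae_all_iff.2 fun n =>
      S.residual_sum ρ (s n) _ fun i _ => hφI i
    have hlim : ∀ᵐ q ∂M, Tendsto (fun n => ‖F n z q‖ₑ ^ 2) atTop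
        (𝓝 (‖S.residual ρ (fun x => ∑ j, a j * κ (z j) x + c) q‖ₑ ^ 2)) := by
      filter_upwards [h1, h2, h3, h4] with q h1 h2 h3 h4
      rw [h1, h2]
      refine ((ENNReal.continuous_pow 2).tendsto _).comp ((continuous_enorm.tendsto _).comp ?_)
      have e : ∀ n, F n z q = ∑ j, a j * ∑ i ∈ s n, (lam i * φ i (z j)) * D i q := fun n => by
        simp only [F, Finset.mul_sum, Finset.sum_mul]
        rw [Finset.sum_comm]
        exact Finset.sum_congr rfl fun j _ => Finset.sum_congr rfl fun i _ => by ring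
      simp_rw [e, ← h4]
      exact tendsto_finsetSum _ fun j _ => (h3 j).const_mul _
    rw [condMSE_eq_lintegral_residual]
    calc _ = ∫⁻ q, liminf (fun n => ‖F n z q‖ₑ ^ 2) atTop ∂M :=
          lintegral_congr_ae (hlim.mono fun q hq => hq.liminf_eq.symm)
      _ ≤ _ := lintegral_liminf_le fun n =>
          ((hF n).comp measurable_prodMk_left).enorm.pow_const 2
  · refine (lintegral_liminf_le hFn).trans (liminf_le_of_frequently_le' (.of_forall fun n => ?_))
    -- The sample `z` is integrated first, with the residuals held fixed; this diagonalizes the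
    -- square.
    rw [lintegral_lintegral_swap ((hF n).enorm.pow_const 2).aemeasurable]
    simp only [F]
    simp_rw [h.lintegral_sum_mul_sq hκ h0 a (s n)]
    have hDm : ∀ i, Measurable fun q => ENNReal.ofReal (lam i ^ 2) * ‖D i q‖ₑ ^ 2 := fun i =>
      ((hD i).enorm.pow_const 2).const_mul _
    rw [lintegral_const_mul _ (Finset.measurable_sum _ fun i _ => hDm i),
      lintegral_finsetSum _ fun i _ => hDm i]
    gcongr
    calc ∑ i ∈ s n, ∫⁻ q, ENNReal.ofReal (lam i ^ 2) * ‖D i q‖ₑ ^ 2 ∂M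
        ≤ ∑ i ∈ s n, ENNReal.ofReal (lam i ^ 2) * ⨆ i, S.condMSE ρ (φ i) := by
          refine Finset.sum_le_sum fun i _ => ?_
          rw [lintegral_const_mul _ ((hD i).enorm.pow_const 2)]
          gcongr
          exact le_iSup (fun i => S.condMSE ρ (φ i)) i
      _ ≤ _ := by
          rw [← Finset.sum_mul, ← ENNReal.ofReal_sum_of_nonneg fun i _ => sq_nonneg _]
          gcongr
          exact h.sum_sq_le hκ (s n)

end LinearSmoother

end UpperBound

/-! ### Combination of the two bounds and passage to the limit. -/

section CrossFit

theorem integral_expectedProduct_self {α : Type*} [MeasurableSpace α] (P : Measure α)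
    (k : α → α → ℝ) :
    ∫ x, expectedProduct P k x x ∂P = ∫ x, ∫ y, centeredKernel P k x y ^ 2 ∂P ∂P := by
  simp only [expectedProduct, sq]

/-- A zero denominator would make the ratio infinite, so finiteness forces `σ > 0`. It also bounds
the second numerator term, which by Fubini is the second moment of `∫ y, κ x y ^ 2`. The term
`E[κ⁴]` is dropped. -/
theorem nullRatio_consequences {α : Type*} [MeasurableSpace α] {P : Measure α}
    [IsProbabilityMeasure P] {k : α → α → ℝ} {ι : Type*} {lam : ι → ℝ} {φ : ι → α → ℝ}
    (hk : Measurable (Function.uncurry k))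
    (h : IsSpectralDecomposition P (centeredKernel P k) lam φ) {n : ℕ} (hn : n ≠ 0)
    (hfin : nullRatio P k n < ∞) :
    0 < ∫ x, ∫ y, centeredKernel P k x y ^ 2 ∂P ∂P ∧
    Integrable (fun x => (∫ y, centeredKernel P k x y ^ 2 ∂P) ^ 2) P ∧
    ENNReal.ofReal ((n : ℝ)⁻¹ * (∫ x, (∫ y, centeredKernel P k x y ^ 2 ∂P) ^ 2 ∂P)
      / (∫ x, ∫ y, centeredKernel P k x y ^ 2 ∂P ∂P) ^ 2) ≤ nullRatio P k n := by
  have hκ : Measurable (Function.uncurry (centeredKernel P k)) := measurable_centeredKernel hk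
  set κ := centeredKernel P k
  set σ := ∫ x, ∫ y, κ x y ^ 2 ∂P ∂P with hσ
  set I := ∫⁻ x₁, ∫⁻ x₂, ∫⁻ x₃, ‖κ x₁ x₂‖ₑ ^ 2 * ‖κ x₁ x₃‖ₑ ^ 2 ∂P ∂P ∂P with hI
  have hκx : ∀ x, Measurable (κ x) := fun x => hκ.of_uncurry_left
  have hn0 : (n : ℝ≥0∞) ≠ 0 := by exact_mod_cast hn
  have hnt : (n : ℝ≥0∞) ≠ ∞ := ENNReal.natCast_ne_top n
  have hle : (n : ℝ≥0∞) * I / ((n : ℝ≥0∞) ^ 2 * ENNReal.ofReal σ ^ 2) ≤ nullRatio P k n := by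
    rw [nullRatio, defRatio, integral_expectedProduct_self]
    split_ifs with hb
    · exact le_top
    · gcongr
      exact le_add_self
  have hb : (n : ℝ≥0∞) ^ 2 * ENNReal.ofReal σ ^ 2 ≠ 0 := by
    intro hb
    rw [nullRatio, defRatio, integral_expectedProduct_self, if_pos hb] at hfin
    exact lt_irrefl _ hfin
  have hσ0 : 0 < σ := by
    by_contra hneg
    rw [ENNReal.ofReal_of_nonpos (not_lt.1 hneg)] at hb
    simp at hb
  have hbt : (n : ℝ≥0∞) ^ 2 * ENNReal.ofReal σ ^ 2 ≠ ∞ :=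
    ENNReal.mul_ne_top (ENNReal.pow_ne_top hnt) (ENNReal.pow_ne_top ENNReal.ofReal_ne_top)
  have hIt : I ≠ ∞ := by
    intro hI'
    rw [hI', ENNReal.mul_top hn0, ENNReal.top_div_of_ne_top hbt] at hle
    exact not_top_lt (hle.trans_lt hfin)
  have hIG : I = ∫⁻ x, ENNReal.ofReal ((∫ y, κ x y ^ 2 ∂P) ^ 2) ∂P := by
    refine lintegral_congr_ae ?_
    filter_upwards [h.ae_memLp hκ] with x hx
    have e : ENNReal.ofReal (∫ y, κ x y ^ 2 ∂P) = ∫⁻ y, ‖κ x y‖ₑ ^ 2 ∂P := by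
      rw [ofReal_integral_eq_lintegral_ofReal hx.integrable_sq (ae_of_all _ fun y => sq_nonneg _)]
      refine lintegral_congr fun y => ?_
      rw [← Real.enorm_of_nonneg (sq_nonneg _), enorm_pow]
    have hm : Measurable fun y => ‖κ x y‖ₑ ^ 2 := (hκx x).enorm.pow_const 2
    rw [ENNReal.ofReal_pow (integral_nonneg fun y => sq_nonneg _), e]
    simp_rw [lintegral_const_mul _ hm]
    rw [lintegral_mul_const _ hm, sq]
  have hgm : Measurable fun x => (∫ y, κ x y ^ 2 ∂P) ^ 2 :=
    ((StronglyMeasurable.integral_prod_right (f := fun x y => κ x y ^ 2)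
      (hκ.pow_const 2).stronglyMeasurable).measurable).pow_const 2
  have hG : Integrable (fun x => (∫ y, κ x y ^ 2 ∂P) ^ 2) P := by
    refine (lintegral_ofReal_ne_top_iff_integrable hgm.aestronglyMeasurable
      (ae_of_all _ fun x => sq_nonneg _)).1 ?_
    rwa [← hIG]
  refine ⟨hσ0, hG, le_trans (le_of_eq ?_) hle⟩
  rw [hIG, ← ofReal_integral_eq_lintegral_ofReal hG (ae_of_all _ fun x => sq_nonneg _),
    ← ENNReal.ofReal_natCast, ← ENNReal.ofReal_pow (by positivity), ← ENNReal.ofReal_pow hσ0.le,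
    ← ENNReal.ofReal_mul (by positivity), ← ENNReal.ofReal_mul (by positivity),
    ← ENNReal.ofReal_div_of_pos (by positivity)]
  congr 1
  have : (n : ℝ) ≠ 0 := by exact_mod_cast hn
  field_simp

namespace LinearSmoother

variable {K 𝒳 𝒱 : Type*} [Fintype K] [MeasurableSpace 𝒳] [MeasurableSpace 𝒱]
  {S : LinearSmoother K 𝒳 𝒱} {ρ : Measure (𝒳 × 𝒱)} [IsProbabilityMeasure ρ]
  {ι : Type*} [Countable ι] {k : 𝒳 → 𝒳 → ℝ} {lam : ι → ℝ} {φ : ι → 𝒳 → ℝ}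

theorem AffineEquivariant.measure_crossFitRatio_le (hS : S.AffineEquivariant ρ)
    (hk : Measurable (Function.uncurry k)) (hp : IsPosDefKernel k)
    (hi : Integrable (fun x => Real.sqrt (k x x)) ρ.fst)
    (h : IsSpectralDecomposition ρ.fst (centeredKernel ρ.fst k) lam φ) {n₁ n₂ : ℕ}
    (h₁ : n₁ ≠ 0) (h₂ : n₂ ≠ 0) (hr₁ : nullRatio ρ.fst k n₁ < ∞)
    (hr₂ : nullRatio ρ.fst k n₂ < ∞) {ε u : ℝ} (hε : 0 < ε) (hu : 0 < u) :
    witnessLaw ρ.fst ρ.fst n₁ n₂ {z | ENNReal.ofReal ε ≤ S.crossFitRatio ρ (witness k z)}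
      ≤ ENNReal.ofReal (u / ε) * (⨆ i, S.condMSE ρ (φ i))
        + (ENNReal.ofReal (Real.exp (1 / 2) * (Real.exp 1 * (Real.sqrt (1 + u / 2))⁻¹))
        + ENNReal.ofReal (Real.exp (1 / 2) * (6 * gaussianFourthMoment * u ^ 2))
          * (nullRatio ρ.fst k n₁ + nullRatio ρ.fst k n₂)) := by
  have hκ : Measurable (Function.uncurry (centeredKernel ρ.fst k)) := measurable_centeredKernel hk
  have h0 := integral_centeredKernel_left (P := ρ.fst) hk hp hi
  have h0' := integral_centeredKernel_right (P := ρ.fst) hk hp hi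
  obtain ⟨hσ0, hG, hG₁⟩ := nullRatio_consequences hk h h₁ hr₁
  obtain ⟨-, -, hG₂⟩ := nullRatio_consequences hk h h₂ hr₂
  set κ := centeredKernel ρ.fst k
  set σ := ∫ x, ∫ y, κ x y ^ 2 ∂ρ.fst ∂ρ.fst
  set G := ∫ x, (∫ y, κ x y ^ 2 ∂ρ.fst) ^ 2 ∂ρ.fst
  set a := witnessWeight n₁ n₂
  have hn₁ : 0 < (n₁ : ℝ) := by exact_mod_cast Nat.pos_of_ne_zero h₁
  have hn₂ : 0 < (n₂ : ℝ) := by exact_mod_cast Nat.pos_of_ne_zero h₂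
  have hA : 0 < ∑ j, a j ^ 2 := by
    rw [sum_sq_witnessWeight n₁ n₂ h₁ h₂]; positivity
  have ha4 : (∑ j, a j ^ 4) / (∑ j, a j ^ 2) ^ 2 ≤ (n₁ : ℝ)⁻¹ + (n₂ : ℝ)⁻¹ := by
    rw [div_le_iff₀ (by positivity), mul_comm]
    exact sum_pow_four_witnessWeight_le n₁ n₂ h₁ h₂
  set A := ∑ j, a j ^ 2
  set ν := Measure.pi fun _ : Fin n₁ ⊕ Fin n₂ => ρ.fst
  obtain ⟨s, hs⟩ := h.exists_lt_sum_sq hκ (half_lt_self hσ0)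
  obtain ⟨L, hLm, hL, hLI⟩ := hS.exists_condMSE_le h hκ h0 a
  have hV := h.ae_sum_sq_le_variance hκ h0' a s
  have hmp : MeasurePreserving (MeasurableEquiv.sumPiEquivProdPi fun _ : Fin n₁ ⊕ Fin n₂ => 𝒳) ν
      (witnessLaw ρ.fst ρ.fst n₁ n₂) := measurePreserving_sumPiEquivProdPi fun _ => ρ.fst
  rw [← hmp.measure_preimage_equiv]
  -- If the variance exceeds `A * σ / u` and the ratio is still at least `ε`, then the numerator is
  -- at least `ε * (A * σ / u)`.
  have hsub : ∀ᵐ z ∂ν, z ∈ (MeasurableEquiv.sumPiEquivProdPi fun _ : Fin n₁ ⊕ Fin n₂ => 𝒳) ⁻¹'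
        {z | ENNReal.ofReal ε ≤ S.crossFitRatio ρ (witness k z)} →
      z ∈ {z | ENNReal.ofReal (ε * (A * σ / u)) ≤ L z}
        ∪ {z | ∑ i ∈ s, (lam i * ∑ j, a j * φ i (z j)) ^ 2 ≤ A * σ / u} := by
    filter_upwards [hL, hV] with z hLz hVz hz
    by_contra hcon
    simp only [Set.mem_union, Set.mem_ofPred_eq, not_or, not_le] at hcon
    obtain ⟨c, hc⟩ := witness_eq_sum_centeredKernel h₁ h₂ ρ.fst k z
    rw [Set.mem_preimage, Set.mem_ofPred_eq, funext hc, crossFitRatio] at hz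
    have hvar := hcon.2.trans_le (hVz c)
    have hpos : 0 < A * σ / u := by positivity
    rw [defRatio, if_neg (by simpa using hpos.trans hvar),
      ENNReal.le_div_iff_mul_le (.inl (by simpa using hpos.trans hvar))
        (.inl ENNReal.ofReal_ne_top), ← ENNReal.ofReal_mul hε.le] at hz
    refine absurd (hz.trans (hLz c)) (not_le.2 (hcon.1.trans_le (ENNReal.ofReal_le_ofReal ?_)))
    gcongr
  refine (measure_mono_ae hsub).trans ((measure_union_le _ _).trans (add_le_add ?_ ?_))
  · have hpos : 0 < ε * (A * σ / u) := by positivity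
    -- Markov's inequality: the factor `A * σ` cancels, leaving `u / ε` times the supremum.
    refine (meas_ge_le_lintegral_div hLm.aemeasurable (by simpa using hpos)
      ENNReal.ofReal_ne_top).trans ((ENNReal.div_le_div_right hLI _).trans (le_of_eq ?_))
    rw [← mul_assoc, ← ENNReal.ofReal_mul hA.le, mul_comm, mul_div_assoc,
      ← ENNReal.ofReal_div_of_pos hpos, mul_comm]
    congr 2
    field_simp
    rfl
  · have hm := h.measure_sum_sq_le hκ h0 hσ0 hG hs.le hA hu
    rw [measureReal_def] at hm
    rw [← ENNReal.ofReal_toReal (measure_ne_top ν _)]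
    have hG0 : 0 ≤ G := integral_nonneg fun x => sq_nonneg _
    have hK := gaussianFourthMoment_nonneg
    calc _ ≤ ENNReal.ofReal (Real.exp (1 / 2) * (Real.exp 1 * (Real.sqrt (1 + u / 2))⁻¹)
          + Real.exp (1 / 2) * (6 * gaussianFourthMoment * u ^ 2)
            * ((n₁ : ℝ)⁻¹ * G / σ ^ 2 + (n₂ : ℝ)⁻¹ * G / σ ^ 2)) := by
          refine ENNReal.ofReal_le_ofReal (hm.trans ?_)
          rw [mul_add]
          refine add_le_add le_rfl ?_
          rw [mul_assoc (Real.exp _)]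
          gcongr
          calc _ ≤ 6 * gaussianFourthMoment * u ^ 2 * ((n₁ : ℝ)⁻¹ + (n₂ : ℝ)⁻¹) * G / σ ^ 2 := by
                gcongr
            _ = _ := by ring
      _ = ENNReal.ofReal (Real.exp (1 / 2) * (Real.exp 1 * (Real.sqrt (1 + u / 2))⁻¹))
        + ENNReal.ofReal (Real.exp (1 / 2) * (6 * gaussianFourthMoment * u ^ 2))
          * (ENNReal.ofReal ((n₁ : ℝ)⁻¹ * G / σ ^ 2)
            + ENNReal.ofReal ((n₂ : ℝ)⁻¹ * G / σ ^ 2)) := by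
          rw [ENNReal.ofReal_add (by positivity) (by positivity),
            ENNReal.ofReal_mul (p := Real.exp (1 / 2) * (6 * gaussianFourthMoment * u ^ 2))
              (by positivity), ENNReal.ofReal_add (by positivity) (by positivity)]
      _ ≤ _ := by gcongr

end LinearSmoother

theorem isLittleOP_crossFitRatio {𝒳 𝒱 ι K : ℕ → Type*} [∀ N, MeasurableSpace (𝒳 N)]
    [∀ N, MeasurableSpace (𝒱 N)] [∀ N, Countable (ι N)] [∀ N, Fintype (K N)] {n₁ n₂ : ℕ → ℕ}
    (hn : Tendsto (fun N => min (n₁ N) (n₂ N)) atTop atTop)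
    (ρ : ∀ N, Measure (𝒳 N × 𝒱 N)) [∀ N, IsProbabilityMeasure (ρ N)]
    {k : ∀ N, 𝒳 N → 𝒳 N → ℝ} (hk_meas : ∀ N, Measurable (Function.uncurry (k N)))
    (hk_pos : ∀ N, IsPosDefKernel (k N))
    (hk_int : ∀ N, Integrable (fun x => Real.sqrt (k N x x)) (ρ N).fst)
    (hmom₁ : Tendsto (fun N => nullRatio (ρ N).fst (k N) (n₁ N)) atTop (𝓝 0))
    (hmom₂ : Tendsto (fun N => nullRatio (ρ N).fst (k N) (n₂ N)) atTop (𝓝 0))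
    {lam : ∀ N, ι N → ℝ} {φ : ∀ N, ι N → 𝒳 N → ℝ}
    (hspec : ∀ N, IsSpectralDecomposition (ρ N).fst (centeredKernel (ρ N).fst (k N))
      (lam N) (φ N))
    (S : ∀ N, LinearSmoother (K N) (𝒳 N) (𝒱 N)) (hS : ∀ N, (S N).AffineEquivariant (ρ N))
    (hΔ : Tendsto (fun N => ⨆ i, (S N).condMSE (ρ N) (φ N i)) atTop (𝓝 0)) :
    IsLittleOP (fun N => witnessLaw (ρ N).fst (ρ N).fst (n₁ N) (n₂ N))
      fun N z => (S N).crossFitRatio (ρ N) (witness (k N) z) := by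
  intro ε hε
  rw [ENNReal.tendsto_nhds_zero]
  intro η hη
  have hu : Tendsto (fun u : ℝ => ENNReal.ofReal
      (Real.exp (1 / 2) * (Real.exp 1 * (Real.sqrt (1 + u / 2))⁻¹))) atTop (𝓝 0) := by
    have h1 : Tendsto (fun u : ℝ => 1 + u / 2) atTop atTop :=
      tendsto_atTop_add_const_left _ _ (tendsto_id.atTop_div_const two_pos)
    have h2 := (tendsto_inv_atTop_zero.comp (Real.tendsto_sqrt_atTop.comp h1))
    have h3 := ENNReal.tendsto_ofReal ((h2.const_mul (Real.exp 1)).const_mul (Real.exp (1 / 2)))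
    simpa using h3
  -- The order matters: `u` is fixed first to make the Gaussian term smaller than `η`, and then `N →
  -- ∞` removes the other terms, whose coefficients depend on `u`.
  obtain ⟨u, hu0, hu⟩ := ((eventually_gt_atTop 0).and (hu.eventually (gt_mem_nhds hη))).exists
  have hlim : Tendsto (fun N => ENNReal.ofReal (u / ε) * (⨆ i, (S N).condMSE (ρ N) (φ N i))
        + (ENNReal.ofReal (Real.exp (1 / 2) * (Real.exp 1 * (Real.sqrt (1 + u / 2))⁻¹))
        + ENNReal.ofReal (Real.exp (1 / 2) * (6 * gaussianFourthMoment * u ^ 2))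
          * (nullRatio (ρ N).fst (k N) (n₁ N) + nullRatio (ρ N).fst (k N) (n₂ N)))) atTop
      (𝓝 (ENNReal.ofReal (Real.exp (1 / 2) * (Real.exp 1 * (Real.sqrt (1 + u / 2))⁻¹)))) := by
    have h1 := ENNReal.Tendsto.const_mul hΔ (a := ENNReal.ofReal (u / ε))
      (.inr ENNReal.ofReal_ne_top)
    have h2 := ENNReal.Tendsto.const_mul (hmom₁.add hmom₂)
      (a := ENNReal.ofReal (Real.exp (1 / 2) * (6 * gaussianFourthMoment * u ^ 2)))
      (.inr ENNReal.ofReal_ne_top)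
    simpa using h1.add (tendsto_const_nhds.add h2)
  filter_upwards [hlim.eventually (gt_mem_nhds hu), hn.eventually_ge_atTop 1,
    hmom₁.eventually (gt_mem_nhds ENNReal.zero_lt_top),
    hmom₂.eventually (gt_mem_nhds ENNReal.zero_lt_top)] with N hN hnN hr₁ hr₂
  refine ((hS N).measure_crossFitRatio_le (hk_meas N) (hk_pos N) (hk_int N) (hspec N) ?_ ?_
    hr₁ hr₂ hε hu0).trans hN.le
  · have := hnN.trans (min_le_left _ _); omega
  · have := hnN.trans (min_le_right _ _); omega

end CrossFit

theorem mainTheorem8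
    {𝒳 𝒱 𝒲 ι : ℕ → Type*}
    [∀ N, MeasurableSpace (𝒳 N)] [∀ N, MeasurableSpace (𝒱 N)] [∀ N, MeasurableSpace (𝒲 N)]
    [∀ N, Countable (ι N)]
    -- labeled sample sizes `n₁, n₂` and unlabeled sample sizes `m₁, m₂`
    (n₁ n₂ m₁ m₂ : ℕ → ℕ)
    (hn : Tendsto (fun N => min (n₁ N) (n₂ N)) atTop atTop)
    (hnm₁ : (fun N => (n₁ N : ℝ)) =Θ[atTop] fun N => (m₁ N : ℝ))
    (hnm₂ : (fun N => (n₂ N : ℝ)) =Θ[atTop] fun N => (m₂ N : ℝ))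
    -- the laws of `(X, V)` and `(Y, W)`
    (PXV : ∀ N, Measure (𝒳 N × 𝒱 N)) [∀ N, IsProbabilityMeasure (PXV N)]
    (PYW : ∀ N, Measure (𝒳 N × 𝒲 N)) [∀ N, IsProbabilityMeasure (PYW N)]
    -- the null hypothesis `P_X = P_Y`
    (hnull : ∀ N, (PXV N).fst = (PYW N).fst)
    -- the kernel, with finite Bochner integral of `‖k(x, ·)‖ = √k(x, x)`
    (k : ∀ N, 𝒳 N → 𝒳 N → ℝ)
    (hk_meas : ∀ N, Measurable (Function.uncurry (k N)))
    (hk_pos : ∀ N, IsPosDefKernel (k N))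
    (hk_int : ∀ N, Integrable (fun x => Real.sqrt (k N x x)) (PXV N).fst)
    -- the null moment condition, for `X` with `n₁` and for `Y` with `n₂`
    (hmomX : Tendsto (fun N => nullRatio (PXV N).fst (k N) (n₁ N)) atTop (𝓝 0))
    (hmomY : Tendsto (fun N => nullRatio (PYW N).fst (k N) (n₂ N)) atTop (𝓝 0))
    -- the spectral decomposition of the centered kernel
    (lam : ∀ N, ι N → ℝ) (φ : ∀ N, ι N → 𝒳 N → ℝ)
    (hspec : ∀ N, IsSpectralDecomposition (PXV N).fst (centeredKernel (PXV N).fst (k N))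
      (lam N) (φ N))
    -- the linear smoothers trained on the two folds of each labeled sample
    (SX : ∀ N (b : Bool), LinearSmoother (Fold (n₁ N) b) (𝒳 N) (𝒱 N))
    (SY : ∀ N (b : Bool), LinearSmoother (Fold (n₂ N) b) (𝒳 N) (𝒲 N))
    (hSX : ∀ N b, (SX N b).AffineEquivariant (PXV N))
    (hSY : ∀ N b, (SY N b).AffineEquivariant (PYW N))
    (hΔX : ∀ b, Tendsto (fun N => ⨆ i, (SX N b).condMSE (PXV N) (φ N i)) atTop (𝓝 0))
    (hΔY : ∀ b, Tendsto (fun N => ⨆ i, (SY N b).condMSE (PYW N) (φ N i)) atTop (𝓝 0)) :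
    (∀ b, IsLittleOP (fun N => witnessLaw (PXV N).fst (PYW N).fst (n₁ N) (n₂ N))
      fun N z => (SX N b).crossFitRatio (PXV N) (witness (k N) z)) ∧
    (∀ b, IsLittleOP (fun N => witnessLaw (PXV N).fst (PYW N).fst (n₁ N) (n₂ N))
      fun N z => (SY N b).crossFitRatio (PYW N) (witness (k N) z)) := by
  refine ⟨fun b => ?_, fun b => ?_⟩
  · simp_rw [← hnull] at hmomY ⊢
    exact isLittleOP_crossFitRatio hn PXV hk_meas hk_pos hk_int hmomX hmomY hspec
      (fun N => SX N b) (fun N => hSX N b) (hΔX b)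
  -- For the second sample everything is expressed through the marginal of `PYW`; the witness law
  -- and the spectral decomposition are the same under the null.
  · simp_rw [hnull] at hk_int hmomX hspec ⊢
    exact isLittleOP_crossFitRatio hn PYW hk_meas hk_pos hk_int hmomX hmomY hspec
      (fun N => SY N b) (fun N => hSY N b) (hΔY b)
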